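/- **Conventions.** A clause is a finite set of literals without complementary pairs; a clause-set is a finite set of clauses, understood as a CNF. For a clause-set $F$ let $n(F)$ be its number of variables, $c(F)=|F|$, and $\ell(F)=\sum_{C\in F}|C|$. For a partial assignment $\varphi$ (with finite domain), $\varphi*F$ is obtained by removing the satisfied clauses and then the falsified literals from the remaining clauses; $F$ is satisfiable if $\varphi*F=\emptyset$ for some $\varphi$. A resolution step derives $(C\cup D)\setminus\{x,\overline x\}$ from clauses $C,D$ clashing in exactly one literal $x$. A prime implicate of $F$ is a clause derivable from $F$ by resolution such that no strict subset of it is derivable; two clause-sets are equivalent if they have the same prime implicates. For a full binary tree, the Horton–Strahler number is $0$ for a single node; for a tree with the two subtrees $T_1,T_2$ at the root it is $1+\mathrm{hts}(T_1)$ if $\mathrm{hts}(T_1)=\mathrm{hts}(T_2)$, and $\max(\mathrm{hts}(T_1),\mathrm{hts}(T_2))$ otherwise. The hardness $\mathrm{hd}(F)$ of an unsatisfiable $F$ is the minimal Horton–Strahler number of a resolution tree deriving the empty clause from $F$; the width-hardness $\mathrm{whd}(F)$ of an unsatisfiable $F$ is the minimal $k$ such that there is a resolution tree deriving the empty clause from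 $F$ in which in every step at least one of the two parent clauses has at most $k$ literals. Both measures are $0$ for $F=\emptyset$, and for other satisfiable $F$ they are the maximum of the measure over all unsatisfiable $\varphi*F$. Put $\mathcal{UC}_k=\{F:\mathrm{hd}(F)\le k\}$ and $\mathcal{WC}_k=\{F:\mathrm{whd}(F)\le k\}$. For classes $\mathcal C,\mathcal C'$ of clause-sets, $\mathcal C'\not\sim\mathcal C$ (“$\mathcal C'$ does not simulate $\mathcal C$”) means: there is a sequence $(F_n)_{n\ge1}$ in $\mathcal C$ with $n(F_n)=n$, with $F_n$ computable in time $n^{O(1)}$ from $n$, such that there is no sequence $(F_n')_{n\ge1}$ in $\mathcal C'$ with $F_n'$ equivalent to $F_n$ for all $n$ and $\ell(F'_n)=n^{O(1)}$. An extremal tree of Horton–Strahler number $k$ and height $h$ is a full binary tree with exactly these parameters which has the maximal number of nodes among all full binary trees of Horton–Strahler number at most $k$ and height at most $h$. For a full binary tree $T$ whose inner nodes are labelled by pairwise different variables, label the edges from an inner node with label $v$ to its left resp. right child by $v$ resp. $\overline v$; the clause-set $\mathrm{smu}_1(T)$ has for each leaf the clause of all literals on the path from the root to this leaf. The doping $D(F)$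 of a clause-set $F$ is obtained by adding to each clause of $F$ a new variable of its own (as a positive literal). **Theorem.** Let $k\ge0$. Then $\mathcal{WC}_k\not\sim\mathcal{UC}_{k+1}$. In detail: for every $h\ge k+1$ there is, up to left-right swaps, exactly one extremal tree of Horton–Strahler number $k+1$ and height $h$. For every $h\ge k+1$ choose such a tree $T_h$ (with any labelling of the inner nodes by different variables), and let $F_h=D(\mathrm{smu}_1(T_h))$. Then: 1. $n(F_h)=\Theta(h^{k+1})$ and $c(F_h)=\Theta(h^{k+1})$ as $h\to\infty$, and $F_h\in\mathcal{UC}_{k+1}$ for all $h\ge k+1$. 2. For every sequence $(F_h')_{h\ge k+1}$ of clause-sets with $F'_h$ equivalent to $F_h$ and $F'_h\in\mathcal{WC}_k$ for all $h\ge k+1$, we have $c(F_h')=\Omega(2^h/\sqrt h)$ as $h\to\infty$. -/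

import Mathlib

namespace ClauseSets

/-! ### Literals, clauses, clause-sets -/

/-- The variables are the natural numbers. The literal `(v, true)` is the variable `v`, the
literal `(v, false)` is its complement. -/
abbrev Lit : Type := ℕ × Bool

/-- The complementary literal. -/
def Lit.compl (x : Lit) : Lit := (x.1, !x.2)

/-- The set of complements of the literals in `C`. -/
def complSet (C : Finset Lit) : Finset Lit := C.image Lit.compl

/-- A clause is a finite complement-free set of literals. -/
def IsClause (C : Finset Lit) : Prop := C ∩ complSet C = ∅

/-- The set of all clause-sets, i.e. of all finite sets of clauses. -/
def CLS : Set (Finset (Finset Lit)) := {F | ∀ C ∈ F, IsClause C}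

/-- The set of variables of a clause. -/
def clauseVars (C : Finset Lit) : Finset ℕ := C.image Prod.fst

/-- The set of variables of a clause-set. -/
def vars (F : Finset (Finset Lit)) : Finset ℕ := F.biUnion clauseVars

/-- The number of variables. -/
def numVars (F : Finset (Finset Lit)) : ℕ := (vars F).card

/-- The number of clauses. -/
def numClauses (F : Finset (Finset Lit)) : ℕ := F.card

/-- The number of literal occurrences. -/
def numLitOcc (F : Finset (Finset Lit)) : ℕ := ∑ C ∈ F, C.card

/-! ### Partial assignments and satisfiability -/

/-- A partial assignment: a map to `{0,1}` from a finite set of variables, `val v = none` meaning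
that `v` is outside the domain. -/
structure PartialAssignment where
  val : ℕ → Option Bool
  finite_dom : {v : ℕ | val v ≠ none}.Finite

/-- The value of a literal, if its variable is assigned. -/
def PartialAssignment.lit (φ : PartialAssignment) (x : Lit) : Option Bool :=
  (φ.val x.1).map (fun ε => if x.2 then ε else !ε)

/-- Application of a partial assignment: satisfied clauses are removed, and falsified literals are
removed from the remaining clauses. -/
def PartialAssignment.apply (φ : PartialAssignment) (F : Finset (Finset Lit)) :
    Finset (Finset Lit) :=
  (F.filter (fun C => ∀ x ∈ C, φ.lit x ≠ some true)).image
    (fun C => C.filter (fun x => φ.lit x ≠ some false))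

def Satisfiable (F : Finset (Finset Lit)) : Prop :=
  ∃ φ : PartialAssignment, φ.apply F = ∅

def Unsatisfiable (F : Finset (Finset Lit)) : Prop := ¬ Satisfiable F

/-! ### Full binary trees -/

/-- Full binary trees. -/
inductive FullTree : Type
  | leaf : FullTree
  | node (l r : FullTree) : FullTree

/-- The height. -/
def FullTree.height : FullTree → ℕ
  | .leaf => 0
  | .node l r => 1 + max l.height r.height

/-- The Horton-Strahler number. -/
def FullTree.hts : FullTree → ℕ
  | .leaf => 0
  | .node l r => if l.hts = r.hts then 1 + max l.hts r.hts else max l.hts r.hts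

/-- The number of nodes. -/
def FullTree.numNodes : FullTree → ℕ
  | .leaf => 1
  | .node l r => 1 + l.numNodes + r.numNodes

/-- Equality of full binary trees up to swaps of left and right subtrees. -/
inductive SwapEquiv : FullTree → FullTree → Prop
  | leaf : SwapEquiv .leaf .leaf
  | node {l r l' r' : FullTree} :
      SwapEquiv l l' → SwapEquiv r r' → SwapEquiv (.node l r) (.node l' r')
  | swap {l r l' r' : FullTree} :
      SwapEquiv l r' → SwapEquiv r l' → SwapEquiv (.node l r) (.node l' r')

/-- The extremal trees of Horton-Strahler number `k` and height `h`: those with the maximal number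
of nodes among all full binary trees of Horton-Strahler number at most `k` and height at most
`h`. -/
def extremalTrees (k h : ℕ) : Set FullTree :=
  {T | T.hts = k ∧ T.height = h ∧
    ∀ T' : FullTree, T'.hts ≤ k → T'.height ≤ h → T'.numNodes ≤ T.numNodes}

/-! ### Resolution trees -/

/-- Binary trees with clauses at the leaves and resolution literals at the inner nodes. -/
inductive ResTree : Type
  | ax (C : Finset Lit) : ResTree
  | res (x : Lit) (S T : ResTree) : ResTree

/-- The clause at the root. -/
def ResTree.concl : ResTree → Finset Lit
  | .ax C => C
  | .res x S T => (S.concl ∪ T.concl) \ {x, x.compl}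

/-- All axioms are in `F`, and every inner node is a resolution step: the parent clauses `C`, `D`
clash in exactly one literal `x`, that is, `C ∩ complSet D = {x}`. -/
def ResTree.IsFrom (F : Finset (Finset Lit)) : ResTree → Prop
  | .ax C => C ∈ F
  | .res x S T => S.IsFrom F ∧ T.IsFrom F ∧ S.concl ∩ complSet T.concl = {x}

/-- The underlying full binary tree. -/
def ResTree.shape : ResTree → FullTree
  | .ax _ => .leaf
  | .res _ S T => .node S.shape T.shape

/-- In every resolution step at least one parent clause has length at most `k`. -/
def ResTree.IsKRes (k : ℕ) : ResTree → Prop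
  | .ax _ => True
  | .res _ S T => S.IsKRes k ∧ T.IsKRes k ∧ (S.concl.card ≤ k ∨ T.concl.card ≤ k)

/-- `Derives F T C`: `T` is a resolution tree deriving `C` from `F`. -/
def Derives (F : Finset (Finset Lit)) (T : ResTree) (C : Finset Lit) : Prop :=
  T.IsFrom F ∧ T.concl = C

/-- The set of prime implicates. -/
def primeImplicates (F : Finset (Finset Lit)) : Set (Finset Lit) :=
  {C | IsClause C ∧ (∃ T, Derives F T C) ∧ ∀ C' : Finset Lit, C' ⊂ C → ¬ ∃ T', Derives F T' C'}

/-- Equivalence of clause-sets. -/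
def Equivalent (F G : Finset (Finset Lit)) : Prop := primeImplicates F = primeImplicates G

/-! ### Hardness and width-hardness -/

/-- The minimal Horton-Strahler number of a resolution refutation. -/
noncomputable def refutationHts (F : Finset (Finset Lit)) : ℕ∞ :=
  ⨅ (T : ResTree) (_ : Derives F T ∅), (T.shape.hts : ℕ∞)

/-- The minimal `k` such that there is a refutation by `k`-resolution. -/
noncomputable def refutationWidth (F : Finset (Finset Lit)) : ℕ∞ :=
  ⨅ (k : ℕ) (_ : ∃ T : ResTree, Derives F T ∅ ∧ T.IsKRes k), (k : ℕ∞)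

open Classical in
/-- Extension of a measure `μ` of unsatisfiable clause-sets to all clause-sets, by maximising over
the unsatisfiable instantiations. -/
noncomputable def extendMeasure (μ : Finset (Finset Lit) → ℕ∞) (F : Finset (Finset Lit)) : ℕ∞ :=
  if Unsatisfiable F then μ F
  else if F = ∅ then 0
  else ⨆ (φ : PartialAssignment) (_ : Unsatisfiable (φ.apply F)), μ (φ.apply F)

/-- The hardness of a clause-set. -/
noncomputable def hardness (F : Finset (Finset Lit)) : ℕ∞ := extendMeasure refutationHts F

/-- The width-hardness of a clause-set. -/
noncomputable def whardness (F : Finset (Finset Lit)) : ℕ∞ := extendMeasure refutationWidth F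

/-- The clause-sets of hardness at most `k`. -/
def UC (k : ℕ) : Set (Finset (Finset Lit)) := {F | F ∈ CLS ∧ hardness F ≤ k}

/-- The clause-sets of width-hardness at most `k`. -/
def WC (k : ℕ) : Set (Finset (Finset Lit)) := {F | F ∈ CLS ∧ whardness F ≤ k}

/-! ### The clause-sets given by labelled trees, and doping -/

/-- Full binary trees with variables at the inner nodes. -/
inductive LTree : Type
  | leaf : LTree
  | node (v : ℕ) (l r : LTree) : LTree

/-- The underlying full binary tree. -/
def LTree.shape : LTree → FullTree
  | .leaf => .leaf
  | .node _ l r => .node l.shape r.shape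

/-- The labels of the inner nodes, with multiplicity. -/
def LTree.labels : LTree → List ℕ
  | .leaf => []
  | .node v l r => v :: (l.labels ++ r.labels)

/-- The edges from an inner node labelled `v` to its left resp. right child carry the literal `v`
resp. its complement. For every leaf there is the clause of all literals on the path from the root
to this leaf. -/
def LTree.smu : LTree → Finset (Finset Lit)
  | .leaf => {∅}
  | .node v l r => l.smu.image (insert (v, true)) ∪ r.smu.image (insert (v, false))

/-- `u` assigns pairwise different new variables to the clauses of `F`. -/
def IsDopingMap (F : Finset (Finset Lit)) (u : Finset Lit → ℕ) : Prop :=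
  Set.InjOn u (F : Set (Finset Lit)) ∧ ∀ C ∈ F, u C ∉ vars F

/-- The doped clause-set: to every clause `C` of `F` the positive literal `u C` is added. -/
def doping (u : Finset Lit → ℕ) (F : Finset (Finset Lit)) : Finset (Finset Lit) :=
  F.image (fun C => insert (u C, true) C)

/-! ### Polynomial-time computable sequences, and non-simulation -/

open Computability in
/-- A literal as a string: its sign, the binary digits of its variable, and a comma. -/
def encodeLit (x : Lit) : List Γ' :=
  Γ'.bit x.2 :: ((encodeNat x.1).map Γ'.bit ++ [Γ'.comma])

open Computability in
/-- A list of literals as a string: the literals, in brackets. -/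
def encodeClause (C : List Lit) : List Γ' :=
  Γ'.bra :: (C.flatMap encodeLit ++ [Γ'.ket])

open Computability in
/-- A list of lists of literals as a string. -/
def encodeClauseList (L : List (List Lit)) : List Γ' := L.flatMap encodeClause

/-- The clause-set presented by a list of lists of literals. -/
def ofClauseList (L : List (List Lit)) : Finset (Finset Lit) := (L.map List.toFinset).toFinset

/-- The sequence `F 1, F 2, …` is computable in time `n ^ O(1)`: some Turing machine computes from
`n` (in unary) in polynomially many steps a list of the clauses of `F n`. -/
def PolyTimeSequence (F : ℕ → Finset (Finset Lit)) : Prop :=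
  ∃ g : ℕ → List (List Lit),
    Nonempty (Turing.TM2ComputableInPolyTime Computability.unaryEncodeNat encodeClauseList g) ∧
    ∀ n : ℕ, 1 ≤ n → F n = ofClauseList (g n)

/-- `𝒞'` does not simulate `𝒞`. -/
def NotSimulates (𝒞' 𝒞 : Set (Finset (Finset Lit))) : Prop :=
  ∃ F : ℕ → Finset (Finset Lit),
    (∀ n : ℕ, 1 ≤ n → F n ∈ 𝒞 ∧ numVars (F n) = n) ∧
    PolyTimeSequence F ∧
    ¬ ∃ F' : ℕ → Finset (Finset Lit),
      (∀ n : ℕ, 1 ≤ n → F' n ∈ 𝒞' ∧ Equivalent (F' n) (F n)) ∧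
      ∃ a : ℕ, Asymptotics.IsBigO Filter.atTop
        (fun n : ℕ => (numLitOcc (F' n) : ℝ)) (fun n : ℕ => (n : ℝ) ^ a)

end ClauseSets

open ClauseSets Asymptotics Filter

namespace ClauseSets

/-! ### Semantics -/

/-! The lower bound is a counting argument about triggers. Suppose `F'` has width-hardness at most
`k` and `C` is an implicate. Falsifying `C` leaves an unsatisfiable clause-set with a `k`-resolution
refutation. Following the short parent upwards from the empty clause ends at an axiom of length at
most `k`, so some clause of `F'` has at most `k` literals outside of `C` and does not clash with `C`
(`exists_trigger`). It therefore suffices to find many implicates such that no single implicate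
triggers many of them; this is `HasSparseTriggers`, and `HasSparseTriggers.le_card` turns it into a
bound on the number of clauses of any equivalent clause-set.

Sparse families are built by recursion. At level `0` distinct minimal implicates work, since an
implicate contained in a minimal one equals it. Branching on a fresh variable over two
variable-disjoint clause-sets raises the level by one (`hasSparseTriggers_branch`): implicates of
the two sides are united in pairs. An implicate that triggers such a union restricts to a trigger of
lower excess on at least one side, so the number of triggered members at most doubles while the size
`N` of the family stays the same.

A doped tree is an iterated branching with unit clauses at its leaves. In the extremal tree of
Horton-Strahler number `k + 1` and height `h`, all nodes of depth `k` exist and carry subtrees of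
height at least `h - k`. Each such subtree has at least `2 ^ (h - k)` minimal implicates, by
doubling along a longest path (`IsDopedTree.exists_minImplicates`). Hence `2 ^ (h - k) ≤ 2 ^ k *
c(F')`, which is stronger than the stated bound. Membership in `UC (k + 1)` holds because
refutations of the two sides of a branching combine exactly as Horton-Strahler numbers do
(`RefutableBy.branch`).

The non-simulation part needs exactly `n` variables for every `n` and a Turing machine, so it uses a
simpler sequence. The leaves of a complete branching tree of depth `k` carry chains of implications,
which are refuted by unit propagation and have `2 ^ m` minimal implicates for length `m`. Clauses
containing a forced variable pad the number of variables. Variables are numbered `2 ^ i * (2 * s +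
1)`, so that a machine with a unary counter can write their binary digits. -/

/-- The total assignment `a` satisfies the clause `C`. -/
def Sat (a : ℕ → Bool) (C : Finset Lit) : Prop := ∃ x ∈ C, a x.1 = x.2

/-- The total assignment `a` satisfies all clauses of `F`. -/
def Models (a : ℕ → Bool) (F : Finset (Finset Lit)) : Prop := ∀ C ∈ F, Sat a C

/-- `C` is an implicate of `F`. -/
def Implies (F : Finset (Finset Lit)) (C : Finset Lit) : Prop := ∀ a, Models a F → Sat a C

@[simp] lemma Lit.compl_compl (x : Lit) : x.compl.compl = x := by
  simp [Lit.compl]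

@[simp] lemma Lit.compl_fst (x : Lit) : x.compl.1 = x.1 := rfl

lemma Lit.compl_ne (x : Lit) : x.compl ≠ x := by
  rcases x with ⟨v, b⟩
  cases b <;> simp [Lit.compl]

lemma mem_complSet {C : Finset Lit} {x : Lit} : x ∈ complSet C ↔ x.compl ∈ C := by
  unfold complSet
  rw [Finset.mem_image]
  constructor
  · rintro ⟨y, hy, rfl⟩
    simpa using hy
  · intro h
    exact ⟨_, h, by simp⟩

lemma isClause_iff {C : Finset Lit} : IsClause C ↔ ∀ x ∈ C, x.compl ∉ C := by
  unfold IsClause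
  rw [Finset.eq_empty_iff_forall_notMem]
  simp [mem_complSet]

lemma IsClause.subset {C D : Finset Lit} (h : IsClause C) (hD : D ⊆ C) : IsClause D := by
  rw [isClause_iff] at *
  exact fun x hx hx' => h x (hD hx) (hD hx')

lemma IsClause.notMem {C : Finset Lit} (h : IsClause C) {v : ℕ} {b : Bool} (hv : (v, b) ∈ C) :
    (v, !b) ∉ C :=
  isClause_iff.1 h (v, b) hv

lemma mem_clauseVars {C : Finset Lit} {v : ℕ} : v ∈ clauseVars C ↔ ∃ b, (v, b) ∈ C := by
  simp [clauseVars]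

lemma mem_clauseVars_of_mem {C : Finset Lit} {x : Lit} (h : x ∈ C) : x.1 ∈ clauseVars C :=
  Finset.mem_image_of_mem _ h

lemma mem_vars {F : Finset (Finset Lit)} {v : ℕ} : v ∈ vars F ↔ ∃ C ∈ F, v ∈ clauseVars C := by
  simp [vars]

lemma clauseVars_subset_vars {F : Finset (Finset Lit)} {C : Finset Lit} (h : C ∈ F) :
    clauseVars C ⊆ vars F := fun _ hv => mem_vars.2 ⟨C, h, hv⟩

lemma clauseVars_insert (x : Lit) (C : Finset Lit) :
    clauseVars (insert x C) = insert x.1 (clauseVars C) := by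
  simp [clauseVars, Finset.image_insert]

lemma clauseVars_union (C D : Finset Lit) :
    clauseVars (C ∪ D) = clauseVars C ∪ clauseVars D := by
  simp [clauseVars, Finset.image_union]

lemma isClause_insert {C : Finset Lit} (h : IsClause C) {x : Lit} (hx : x.1 ∉ clauseVars C) :
    IsClause (insert x C) := by
  rw [isClause_iff] at *
  intro y hy hy'
  rcases Finset.mem_insert.1 hy with rfl | hy
  · rcases Finset.mem_insert.1 hy' with h' | h'
    · exact Lit.compl_ne _ h'
    · exact hx (mem_clauseVars_of_mem (x := y.compl) h')
  · rcases Finset.mem_insert.1 hy' with h' | h'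
    · exact hx (by rw [← h']; exact mem_clauseVars_of_mem (x := y) hy)
    · exact h y hy h'

lemma isClause_union {C D : Finset Lit} (hC : IsClause C) (hD : IsClause D)
    (h : Disjoint (clauseVars C) (clauseVars D)) : IsClause (C ∪ D) := by
  rw [isClause_iff] at *
  intro y hy hy'
  rcases Finset.mem_union.1 hy with hy | hy <;> rcases Finset.mem_union.1 hy' with h' | h'
  · exact hC y hy h'
  · exact Finset.disjoint_left.1 h (mem_clauseVars_of_mem hy)
      (mem_clauseVars_of_mem (x := y.compl) h')
  · exact Finset.disjoint_left.1 h (mem_clauseVars_of_mem (x := y.compl) h')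
      (mem_clauseVars_of_mem (x := y) hy)
  · exact hD y hy h'

lemma Sat.mono {a : ℕ → Bool} {C D : Finset Lit} (h : Sat a C) (hCD : C ⊆ D) : Sat a D :=
  let ⟨x, hx, h⟩ := h
  ⟨x, hCD hx, h⟩

lemma Sat.congr {a b : ℕ → Bool} {C : Finset Lit} (h : Sat a C)
    (hab : ∀ v ∈ clauseVars C, a v = b v) : Sat b C :=
  let ⟨x, hx, h⟩ := h
  ⟨x, hx, by rw [← hab _ (mem_clauseVars_of_mem hx), h]⟩

lemma Models.congr {a b : ℕ → Bool} {F : Finset (Finset Lit)} (h : Models a F)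
    (hab : ∀ v ∈ vars F, a v = b v) : Models b F :=
  fun C hC => (h C hC).congr fun v hv => hab v (clauseVars_subset_vars hC hv)

/-- An assignment falsifying the clause `C`. -/
def falsifier (C : Finset Lit) (v : ℕ) : Bool := decide ((v, false) ∈ C)

lemma falsifier_ne {C : Finset Lit} (h : IsClause C) {x : Lit} (hx : x ∈ C) :
    falsifier C x.1 ≠ x.2 := by
  rcases x with ⟨v, b⟩
  cases b
  · simpa [falsifier] using hx
  · have := h.notMem hx
    simpa [falsifier] using this

/-! ### Soundness of resolution -/

/-- A complementary pair in the resolvent would have one literal in each parent, hence be a second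
clash of the parents. -/
lemma ResTree.isClause_concl {F : Finset (Finset Lit)} (hF : F ∈ CLS) :
    ∀ T : ResTree, T.IsFrom F → IsClause T.concl
  | .ax C, h => hF C h
  | .res x S T, ⟨hS, hT, hx⟩ => by
    have h1 := isClause_iff.1 (ResTree.isClause_concl hF S hS)
    have h2 := isClause_iff.1 (ResTree.isClause_concl hF T hT)
    have key : ∀ y, y ∈ S.concl → y.compl ∈ T.concl → y = x := by
      intro y hy hy'
      have : y ∈ S.concl ∩ complSet T.concl := Finset.mem_inter.2 ⟨hy, mem_complSet.2 hy'⟩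
      rw [hx] at this
      simpa using this
    rw [isClause_iff]
    intro y hy hy'
    simp only [ResTree.concl, Finset.mem_sdiff, Finset.mem_union, Finset.mem_insert,
      Finset.mem_singleton, not_or] at hy hy'
    rcases hy with ⟨hy | hy, hyx, hyx'⟩
    · rcases hy'.1 with h' | h'
      · exact h1 y hy h'
      · exact hyx (key y hy h')
    · rcases hy'.1 with h' | h'
      · exact hy'.2.1 (key _ h' (by simpa using hy))
      · exact h2 y hy h'

lemma ResTree.sound {F : Finset (Finset Lit)} (hF : F ∈ CLS) :
    ∀ T : ResTree, T.IsFrom F → Implies F T.concl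
  | .ax C, h => fun _ ha => ha C h
  | .res x S T, ⟨hS, hT, hx⟩ => by
    intro a ha
    have hxm : x ∈ S.concl ∩ complSet T.concl := by rw [hx]; simp
    rw [Finset.mem_inter, mem_complSet] at hxm
    have h1 := isClause_iff.1 (ResTree.isClause_concl hF S hS)
    have h2 := isClause_iff.1 (ResTree.isClause_concl hF T hT)
    by_cases hax : a x.1 = x.2
    · obtain ⟨y, hy, hay⟩ := ResTree.sound hF T hT a ha
      refine ⟨y, ?_, hay⟩
      simp only [ResTree.concl, Finset.mem_sdiff, Finset.mem_union, Finset.mem_insert,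
        Finset.mem_singleton, not_or]
      refine ⟨Or.inr hy, ?_, ?_⟩
      · rintro rfl
        exact h2 y hy hxm.2
      · rintro rfl
        simp [Lit.compl] at hay
        simp [hay] at hax
    · obtain ⟨y, hy, hay⟩ := ResTree.sound hF S hS a ha
      refine ⟨y, ?_, hay⟩
      simp only [ResTree.concl, Finset.mem_sdiff, Finset.mem_union, Finset.mem_insert,
        Finset.mem_singleton, not_or]
      refine ⟨Or.inl hy, ?_, ?_⟩
      · rintro rfl
        exact hax hay
      · rintro rfl
        exact h1 x hxm.1 hy

/-- Every clause of `F` is derivable, and passing to smaller derivable subsets terminates. -/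
lemma exists_primeImplicate_subset {F : Finset (Finset Lit)} (hF : F ∈ CLS) {C : Finset Lit}
    (hC : C ∈ F) : ∃ D ∈ primeImplicates F, D ⊆ C := by
  have key : ∀ n (C : Finset Lit), C.card ≤ n → IsClause C → (∃ T, Derives F T C) →
      ∃ D ∈ primeImplicates F, D ⊆ C := by
    intro n
    induction n with
    | zero =>
      intro C hn hcl hT
      rw [Nat.le_zero, Finset.card_eq_zero] at hn
      subst hn
      exact ⟨∅, ⟨hcl, hT, fun C' hC' => absurd hC' (Finset.not_ssubset_empty _)⟩,
        Finset.Subset.refl _⟩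
    | succ n ih =>
      intro C hn hcl hT
      by_cases h : ∃ C', C' ⊂ C ∧ ∃ T', Derives F T' C'
      · obtain ⟨C', hC', hT'⟩ := h
        obtain ⟨D, hD, hDC⟩ := ih C' (by have := Finset.card_lt_card hC'; omega)
          (hcl.subset hC'.1) hT'
        exact ⟨D, hD, hDC.trans hC'.1⟩
      · push Not at h
        exact ⟨C, ⟨hcl, hT, fun C' hC' ⟨T', hT'⟩ => h C' hC' T' hT'⟩, Finset.Subset.refl _⟩
  exact key _ C le_rfl (hF C hC) ⟨.ax C, hC, rfl⟩

/-- Each clause of `G` contains a prime implicate of `G`, which is also derivable from `F`.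
Soundness of resolution is enough here; completeness is never needed. -/
lemma Equivalent.models {F G : Finset (Finset Lit)} (hF : F ∈ CLS) (hG : G ∈ CLS)
    (h : Equivalent F G) {a : ℕ → Bool} (ha : Models a F) : Models a G := by
  intro C hC
  obtain ⟨D, hD, hDC⟩ := exists_primeImplicate_subset hG hC
  rw [← show primeImplicates F = primeImplicates G from h] at hD
  obtain ⟨-, ⟨T, hT, rfl⟩, -⟩ := hD
  exact (ResTree.sound hF T hT a ha).mono hDC

/-! ### Partial assignments -/

/-- The total assignment `a` extends `φ`. -/
def PartialAssignment.ExtendedBy (φ : PartialAssignment) (a : ℕ → Bool) : Prop :=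
  ∀ v b, φ.val v = some b → a v = b

lemma PartialAssignment.lit_eq_some {φ : PartialAssignment} {x : Lit} {b : Bool} :
    φ.lit x = some b ↔ φ.val x.1 = some (if b then x.2 else !x.2) := by
  rcases x with ⟨v, c⟩
  unfold PartialAssignment.lit
  cases h : φ.val v with
  | none => simp
  | some e => cases b <;> cases c <;> cases e <;> simp

lemma PartialAssignment.mem_apply {φ : PartialAssignment} {F : Finset (Finset Lit)}
    {D : Finset Lit} : D ∈ φ.apply F ↔
      ∃ C ∈ F, (∀ x ∈ C, φ.lit x ≠ some true) ∧ C.filter (fun x => φ.lit x ≠ some false) = D := by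
  simp only [PartialAssignment.apply, Finset.mem_image, Finset.mem_filter, and_assoc]

lemma PartialAssignment.apply_mono (φ : PartialAssignment) {F G : Finset (Finset Lit)}
    (h : F ⊆ G) : φ.apply F ⊆ φ.apply G := by
  intro D hD
  rw [PartialAssignment.mem_apply] at *
  obtain ⟨C, hC, hD⟩ := hD
  exact ⟨C, h hC, hD⟩

lemma PartialAssignment.vars_apply_subset (φ : PartialAssignment) (F : Finset (Finset Lit)) :
    vars (φ.apply F) ⊆ vars F := by
  intro v hv
  obtain ⟨D, hD, hv⟩ := mem_vars.1 hv
  obtain ⟨C, hC, -, rfl⟩ := PartialAssignment.mem_apply.1 hD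
  exact mem_vars.2 ⟨C, hC, Finset.image_subset_image (Finset.filter_subset _ _) hv⟩

lemma PartialAssignment.models_of_models_apply {φ : PartialAssignment} {a : ℕ → Bool}
    (hφ : φ.ExtendedBy a) {F : Finset (Finset Lit)} (h : Models a (φ.apply F)) : Models a F := by
  intro C hC
  by_cases hs : ∀ x ∈ C, φ.lit x ≠ some true
  · exact (h _ (PartialAssignment.mem_apply.2 ⟨C, hC, hs, rfl⟩)).mono (Finset.filter_subset _ _)
  · push Not at hs
    obtain ⟨x, hx, hxs⟩ := hs
    exact ⟨x, hx, hφ _ _ (by simpa [PartialAssignment.lit_eq_some] using hxs)⟩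

lemma satisfiable_iff {F : Finset (Finset Lit)} : Satisfiable F ↔ ∃ a, Models a F := by
  constructor
  · rintro ⟨φ, hφ⟩
    refine ⟨fun v => (φ.val v).getD true, PartialAssignment.models_of_models_apply (φ := φ) ?_ ?_⟩
    · intro v b h
      simp [h]
    · rw [hφ]
      exact fun C hC => absurd hC (Finset.notMem_empty C)
  · rintro ⟨a, ha⟩
    refine ⟨⟨fun v => if v ∈ vars F then some (a v) else none, ?_⟩, ?_⟩
    · refine (vars F).finite_toSet.subset fun v hv => ?_
      by_contra h
      simp at h
      simp [h] at hv
    · rw [Finset.eq_empty_iff_forall_notMem]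
      intro D hD
      obtain ⟨C, hC, h, -⟩ := PartialAssignment.mem_apply.1 hD
      obtain ⟨x, hx, hax⟩ := ha C hC
      refine h x hx ?_
      rw [PartialAssignment.lit_eq_some]
      simp [clauseVars_subset_vars hC (mem_clauseVars_of_mem hx), hax]

lemma unsatisfiable_apply_iff {φ : PartialAssignment} {F : Finset (Finset Lit)} :
    Unsatisfiable (φ.apply F) ↔ ∀ a, φ.ExtendedBy a → ¬ Models a F := by
  unfold Unsatisfiable
  rw [satisfiable_iff]
  constructor
  · intro h a ha hF
    refine h ⟨a, fun D hD => ?_⟩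
    obtain ⟨C, hC, hs, rfl⟩ := PartialAssignment.mem_apply.1 hD
    obtain ⟨x, hx, hax⟩ := hF C hC
    refine ⟨x, Finset.mem_filter.2 ⟨hx, fun hf => ?_⟩, hax⟩
    rw [PartialAssignment.lit_eq_some] at hf
    have := ha _ _ hf
    rw [hax] at this
    simp at this
  · rintro h ⟨a, ha⟩
    refine h (fun v => (φ.val v).getD (a v)) (fun v b hv => by simp [hv]) ?_
    intro C hC
    by_cases hs : ∀ x ∈ C, φ.lit x ≠ some true
    · obtain ⟨x, hx, hax⟩ := ha _ (PartialAssignment.mem_apply.2 ⟨C, hC, hs, rfl⟩)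
      rw [Finset.mem_filter] at hx
      refine ⟨x, hx.1, ?_⟩
      cases hv : φ.val x.1 with
      | none => simpa [hv] using hax
      | some e =>
        have h1 := hs x hx.1
        have h2 := hx.2
        rw [Ne, PartialAssignment.lit_eq_some, hv] at h1 h2
        rcases x with ⟨v, c⟩
        cases c <;> cases e <;> simp_all
    · push Not at hs
      obtain ⟨x, hx, hxs⟩ := hs
      rw [PartialAssignment.lit_eq_some] at hxs
      exact ⟨x, hx, by simp [hxs]⟩

/-- The partial assignment falsifying exactly the literals of the clause `C`. -/
def falsifying (C : Finset Lit) : PartialAssignment where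
  val v := if (v, true) ∈ C then some false else if (v, false) ∈ C then some true else none
  finite_dom := by
    refine (clauseVars C).finite_toSet.subset fun v hv => ?_
    by_contra h
    simp only [Finset.mem_coe, mem_clauseVars, not_exists] at h
    simp [h] at hv

lemma falsifying_lit_eq_false {C : Finset Lit} (hC : IsClause C) {x : Lit} :
    (falsifying C).lit x = some false ↔ x ∈ C := by
  rw [PartialAssignment.lit_eq_some]
  rcases x with ⟨v, b⟩
  by_cases h : (v, true) ∈ C
  · have := hC.notMem h
    cases b <;> simp_all [falsifying]
  · cases b <;> simp_all [falsifying]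

lemma falsifying_lit_eq_true {C : Finset Lit} (hC : IsClause C) {x : Lit} :
    (falsifying C).lit x = some true ↔ x.compl ∈ C := by
  rw [← falsifying_lit_eq_false hC, PartialAssignment.lit_eq_some, PartialAssignment.lit_eq_some]
  simp [Lit.compl]

/-! ### Clause-sets of small width-hardness -/

/-- Some parent of every step is short, so shortness passes from the root to a leaf. -/
lemma ResTree.exists_short_axiom_of_concl {F : Finset (Finset Lit)} {k : ℕ} :
    ∀ T : ResTree, T.IsFrom F → T.IsKRes k → T.concl.card ≤ k → ∃ C ∈ F, C.card ≤ k
  | .ax C, h, _, hc => ⟨C, h, hc⟩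
  | .res _ S T, ⟨hS, hT, _⟩, ⟨kS, kT, h⟩, _ => by
    rcases h with h | h
    · exact exists_short_axiom_of_concl S hS kS h
    · exact exists_short_axiom_of_concl T hT kT h

lemma exists_short_clause_of_refutationWidth_le {F : Finset (Finset Lit)} {k : ℕ}
    (h : refutationWidth F ≤ k) : ∃ C ∈ F, C.card ≤ k := by
  -- An infimum in `ℕ∞` yields a witness only from a strict inequality, hence the passage to `k +
  -- 1`.
  have h' : refutationWidth F < (k + 1 : ℕ) := lt_of_le_of_lt h (by exact_mod_cast Nat.lt_succ_self k)
  simp only [refutationWidth, iInf_lt_iff] at h'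
  obtain ⟨j, ⟨T, ⟨hT, hc⟩, hj⟩, hlt⟩ := h'
  have hlt : j < k + 1 := by exact_mod_cast hlt
  obtain ⟨C, hC, hCj⟩ := T.exists_short_axiom_of_concl hT hj (by simp [hc])
  exact ⟨C, hC, by omega⟩

/-- In a clause-set of width-hardness at most `k`, every implicate `C` is triggered by a clause
with at most `k` literals outside of `C` and without clashes with `C`. -/
lemma exists_trigger {F : Finset (Finset Lit)} {k : ℕ} (hF : F ∈ WC k) {a : ℕ → Bool}
    (ha : Models a F) {C : Finset Lit} (hC : IsClause C) (hFC : Implies F C) :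
    ∃ D ∈ F, (D \ C).card ≤ k ∧ ∀ x ∈ D, x.compl ∉ C := by
  have hun : Unsatisfiable ((falsifying C).apply F) := by
    rw [unsatisfiable_apply_iff]
    intro b hb hbF
    obtain ⟨x, hx, hbx⟩ := hFC b hbF
    have h1 := (falsifying_lit_eq_false hC).2 hx
    rw [PartialAssignment.lit_eq_some] at h1
    have := hb _ _ h1
    rw [hbx] at this
    simp at this
  have hne : F ≠ ∅ := by
    rintro rfl
    exact hun ⟨falsifying C, by simp [PartialAssignment.apply]⟩
  have hle := hF.2
  -- Satisfiability and `F ≠ ∅` select the supremum in `extendMeasure`; falsifying `C` is one of its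
  -- instantiations.
  have hsat : ¬ Unsatisfiable F := not_not.2 (satisfiable_iff.2 ⟨a, ha⟩)
  rw [whardness, extendMeasure, if_neg hsat, if_neg hne] at hle
  have := (iSup_le_iff.1 (iSup_le_iff.1 hle (falsifying C))) hun
  obtain ⟨D', hD', hk⟩ := exists_short_clause_of_refutationWidth_le this
  obtain ⟨D, hD, hDs, rfl⟩ := PartialAssignment.mem_apply.1 hD'
  refine ⟨D, hD, ?_, fun x hx hxC => hDs x hx ((falsifying_lit_eq_true hC).2 hxC)⟩
  refine le_trans (Finset.card_le_card fun x hx => ?_) hk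
  rw [Finset.mem_sdiff] at hx
  rw [Finset.mem_filter]
  exact ⟨hx.1, fun h => hx.2 ((falsifying_lit_eq_false hC).1 h)⟩

/-! ### Restriction of implicates -/

/-- The literals of `C` over the variables in `X`. -/
def restr (C : Finset Lit) (X : Finset ℕ) : Finset Lit := C.filter (fun x => x.1 ∈ X)

lemma mem_restr {C : Finset Lit} {X : Finset ℕ} {x : Lit} : x ∈ restr C X ↔ x ∈ C ∧ x.1 ∈ X :=
  Finset.mem_filter

lemma restr_subset (C : Finset Lit) (X : Finset ℕ) : restr C X ⊆ C := Finset.filter_subset _ _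

/-- A model of `E` is changed outside `vars E`: to `s` at `v`, and elsewhere so as to falsify `C`.
The literal of `C` that is then satisfied has its variable in `vars E`. -/
lemma implies_restr_of {F E : Finset (Finset Lit)} {C : Finset Lit} {v : ℕ} {s : Bool}
    (hC : IsClause C) (hFC : Implies F C) (hvC : (v, s) ∉ C) (hv : v ∉ vars E)
    (hE : ∀ b, b v = s → Models b E → Models b F) : Implies E (restr C (vars E)) := by
  intro a ha
  let b : ℕ → Bool := fun w => if w ∈ vars E then a w else if w = v then s else falsifier C w
  obtain ⟨x, hx, hbx⟩ := hFC b (hE b (by simp [b, hv]) (ha.congr fun w hw => by simp [b, hw]))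
  by_cases h : x.1 ∈ vars E
  · exact ⟨x, mem_restr.2 ⟨hx, h⟩, by simpa [b, h] using hbx⟩
  · by_cases hxv : x.1 = v
    · simp only [b, hxv, hv, if_false, if_true] at hbx
      exact absurd (by rw [hbx, ← hxv]; exact hx) hvC
    · simp only [b, h, hxv, if_false] at hbx
      exact absurd hbx (falsifier_ne hC hx)

lemma implies_restr {E : Finset (Finset Lit)} {C : Finset Lit} (hC : IsClause C)
    (h : Implies E C) : Implies E (restr C (vars E)) := by
  obtain ⟨v, hv⟩ := Infinite.exists_notMem_finset (vars E ∪ clauseVars C)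
  rw [Finset.mem_union, not_or] at hv
  exact implies_restr_of (s := true) hC h (fun h => hv.2 (mem_clauseVars_of_mem h)) hv.1
    fun b _ hb => hb

/-! ### Branching on a variable -/

/-- The clause-set with the clauses of `E` extended by `v` and those of `E'` extended by the
complement of `v`. -/
def branch (v : ℕ) (E E' : Finset (Finset Lit)) : Finset (Finset Lit) :=
  E.image (insert (v, true)) ∪ E'.image (insert (v, false))

lemma mem_branch {v : ℕ} {E E' : Finset (Finset Lit)} {C : Finset Lit} :
    C ∈ branch v E E' ↔ (∃ D ∈ E, insert (v, true) D = C) ∨ ∃ D ∈ E', insert (v, false) D = C := by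
  simp [branch]

lemma models_branch {v : ℕ} {E E' : Finset (Finset Lit)} {a : ℕ → Bool} :
    Models a (branch v E E') ↔ (a v = false → Models a E) ∧ (a v = true → Models a E') := by
  have key : ∀ (s : Bool) (D : Finset Lit),
      Sat a (insert (v, s) D) ↔ (a v = s ∨ Sat a D) := by
    intro s D
    simp only [Sat, Finset.mem_insert, or_and_right, exists_or, exists_eq_left]
  constructor
  · intro h
    constructor
    · intro hv D hD
      have := (key true D).1 (h _ (mem_branch.2 (Or.inl ⟨D, hD, rfl⟩)))
      simpa [hv] using this
    · intro hv D hD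
      have := (key false D).1 (h _ (mem_branch.2 (Or.inr ⟨D, hD, rfl⟩)))
      simpa [hv] using this
  · rintro ⟨h1, h2⟩ C hC
    rcases mem_branch.1 hC with ⟨D, hD, rfl⟩ | ⟨D, hD, rfl⟩
    · rw [key]
      cases hv : a v
      · exact Or.inr (h1 hv D hD)
      · exact Or.inl rfl
    · rw [key]
      cases hv : a v
      · exact Or.inl rfl
      · exact Or.inr (h2 hv D hD)

lemma vars_branch_subset (v : ℕ) (E E' : Finset (Finset Lit)) :
    vars (branch v E E') ⊆ insert v (vars E ∪ vars E') := by
  intro w hw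
  obtain ⟨C, hC, hw⟩ := mem_vars.1 hw
  rw [Finset.mem_insert, Finset.mem_union]
  rcases mem_branch.1 hC with ⟨D, hD, rfl⟩ | ⟨D, hD, rfl⟩ <;>
  · rw [clauseVars_insert, Finset.mem_insert] at hw
    rcases hw with hw | hw
    · exact Or.inl hw
    · have := clauseVars_subset_vars hD hw
      tauto

lemma vars_branch (v : ℕ) {E E' : Finset (Finset Lit)} (hE : E.Nonempty) :
    vars (branch v E E') = insert v (vars E ∪ vars E') := by
  refine Finset.Subset.antisymm (vars_branch_subset v E E') fun w hw => ?_
  rw [Finset.mem_insert, Finset.mem_union] at hw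
  rcases hw with rfl | hw | hw
  · obtain ⟨C, hC⟩ := hE
    exact mem_vars.2 ⟨_, mem_branch.2 (Or.inl ⟨C, hC, rfl⟩), by simp [clauseVars_insert]⟩
  · obtain ⟨C, hC, hw⟩ := mem_vars.1 hw
    exact mem_vars.2 ⟨_, mem_branch.2 (Or.inl ⟨C, hC, rfl⟩), by simp [clauseVars_insert, hw]⟩
  · obtain ⟨C, hC, hw⟩ := mem_vars.1 hw
    exact mem_vars.2 ⟨_, mem_branch.2 (Or.inr ⟨C, hC, rfl⟩), by simp [clauseVars_insert, hw]⟩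

lemma branch_nonempty (v : ℕ) {E E' : Finset (Finset Lit)} (hE : E.Nonempty) :
    (branch v E E').Nonempty := by
  obtain ⟨C, hC⟩ := hE
  exact ⟨_, mem_branch.2 (Or.inl ⟨C, hC, rfl⟩)⟩

lemma branch_mem_CLS {v : ℕ} {E E' : Finset (Finset Lit)} (hE : E ∈ CLS) (hE' : E' ∈ CLS)
    (hv : v ∉ vars E) (hv' : v ∉ vars E') : branch v E E' ∈ CLS := by
  intro C hC
  rcases mem_branch.1 hC with ⟨D, hD, rfl⟩ | ⟨D, hD, rfl⟩
  · exact isClause_insert (hE D hD) fun h => hv (clauseVars_subset_vars hD h)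
  · exact isClause_insert (hE' D hD) fun h => hv' (clauseVars_subset_vars hD h)

lemma implies_restr_branch_left {v : ℕ} {E E' : Finset (Finset Lit)} {C : Finset Lit}
    (hC : IsClause C) (h : Implies (branch v E E') C) (hvC : (v, false) ∉ C) (hv : v ∉ vars E) :
    Implies E (restr C (vars E)) :=
  implies_restr_of hC h hvC hv fun b hb hE => models_branch.2
    ⟨fun _ => hE, fun h => by simp [hb] at h⟩

lemma implies_restr_branch_right {v : ℕ} {E E' : Finset (Finset Lit)} {C : Finset Lit}
    (hC : IsClause C) (h : Implies (branch v E E') C) (hvC : (v, true) ∉ C) (hv : v ∉ vars E') :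
    Implies E' (restr C (vars E')) :=
  implies_restr_of hC h hvC hv fun b hb hE => models_branch.2
    ⟨fun h => by simp [hb] at h, fun _ => hE⟩

lemma Implies.branch_union {v : ℕ} {E E' : Finset (Finset Lit)} {C C' : Finset Lit}
    (h : Implies E C) (h' : Implies E' C') : Implies (branch v E E') (C ∪ C') := by
  intro a ha
  rw [models_branch] at ha
  cases hv : a v
  · exact (h a (ha.1 hv)).mono Finset.subset_union_left
  · exact (h' a (ha.2 hv)).mono Finset.subset_union_right

lemma Implies.branch_left {v : ℕ} {E E' : Finset (Finset Lit)} {C : Finset Lit}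
    (h : Implies E C) : Implies (branch v E E') (insert (v, true) C) := by
  intro a ha
  rw [models_branch] at ha
  cases hv : a v
  · exact (h a (ha.1 hv)).mono (Finset.subset_insert _ _)
  · exact ⟨(v, true), Finset.mem_insert_self _ _, hv⟩

/-! ### Trigger bounds -/

/-- `E` has a family of `N` implicates such that every implicate of `E` has at most `j` literals
outside of at most `2 ^ j` members of the family. -/
def HasSparseTriggers (j N : ℕ) (E : Finset (Finset Lit)) : Prop :=
  ∃ S : Fin N → Finset Lit,
    (∀ i, IsClause (S i) ∧ clauseVars (S i) ⊆ vars E ∧ Implies E (S i)) ∧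
    ∀ C, IsClause C → Implies E C →
      (Finset.univ.filter fun i => (restr C (vars E) \ S i).card ≤ j).card ≤ 2 ^ j

/-- Minimal implicates, in the semantic sense. -/
def IsMinImplicate (E : Finset (Finset Lit)) (C : Finset Lit) : Prop :=
  IsClause C ∧ clauseVars C ⊆ vars E ∧ Implies E C ∧ ∀ D ⊆ C, Implies E D → D = C

/-- Excess `0` means that the restricted implicate is a subset of the member. By minimality it then
equals the member, and this happens for at most one index. -/
lemma hasSparseTriggers_zero {E : Finset (Finset Lit)} {A : Finset (Finset Lit)} {N : ℕ}
    (hN : N ≤ A.card) (hA : ∀ C ∈ A, IsMinImplicate E C) : HasSparseTriggers 0 N E := by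
  obtain ⟨B, hBA, hB⟩ := Finset.exists_subset_card_eq hN
  let e := B.equivFinOfCardEq hB
  refine ⟨fun i => (e.symm i : Finset Lit), fun i => ?_, fun C hC hEC => ?_⟩
  · have := hA _ (hBA (e.symm i).2)
    exact ⟨this.1, this.2.1, this.2.2.1⟩
  · rw [pow_zero, Finset.card_le_one]
    have key : ∀ i, (restr C (vars E) \ (e.symm i : Finset Lit)).card ≤ 0 →
        restr C (vars E) = (e.symm i : Finset Lit) := by
      intro i hi
      rw [Nat.le_zero, Finset.card_eq_zero, Finset.sdiff_eq_empty_iff_subset] at hi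
      exact (hA _ (hBA (e.symm i).2)).2.2.2 _ hi (implies_restr hC hEC)
    intro i hi i' hi'
    rw [Finset.mem_filter] at hi hi'
    exact e.symm.injective (Subtype.ext ((key i hi.2).symm.trans (key i' hi'.2)))

/-- The excess of an implicate `C` over `S i ∪ S' i` is at least the sum of its excesses on the two
sides, plus one if `C` mentions `v`. A literal of `v` thus pays for the extra unit, and only the
side where `C` still gives an implicate is used. Without `v`, both sides give implicates, and two
excesses above `j` cannot add up to at most `j + 1`. -/
lemma hasSparseTriggers_branch {j N v : ℕ} {E E' : Finset (Finset Lit)}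
    (h : HasSparseTriggers j N E) (h' : HasSparseTriggers j N E') (hne : E.Nonempty)
    (hv : v ∉ vars E) (hv' : v ∉ vars E') (hd : Disjoint (vars E) (vars E')) :
    HasSparseTriggers (j + 1) N (branch v E E') := by
  obtain ⟨S, hS, hb⟩ := h
  obtain ⟨S', hS', hb'⟩ := h'
  have hvS : ∀ i s, (v, s) ∉ S i ∪ S' i := by
    intro i s hm
    rcases Finset.mem_union.1 hm with hm | hm
    · exact hv ((hS i).2.1 (mem_clauseVars_of_mem hm))
    · exact hv' ((hS' i).2.1 (mem_clauseVars_of_mem hm))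
  refine ⟨fun i => S i ∪ S' i, fun i => ⟨?_, ?_, ?_⟩, fun C hC hEC => ?_⟩
  · exact isClause_union (hS i).1 (hS' i).1 (hd.mono (hS i).2.1 (hS' i).2.1)
  · rw [vars_branch v hne, clauseVars_union]
    exact (Finset.union_subset_union (hS i).2.1 (hS' i).2.1).trans (Finset.subset_insert _ _)
  · exact (hS i).2.2.branch_union (hS' i).2.2
  · let D := restr C (vars (branch v E E'))
    let A := restr C (vars E)
    let B := restr C (vars E')
    have hDv : ∀ s, (v, s) ∈ C → (v, s) ∈ D := fun s hs =>
      mem_restr.2 ⟨hs, by rw [vars_branch v hne]; exact Finset.mem_insert_self _ _⟩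
    have hsub : ∀ i, (A \ S i) ∪ (B \ S' i) ⊆ D \ (S i ∪ S' i) := by
      intro i x hx
      have hX := vars_branch v (E' := E') hne
      rw [Finset.mem_union, Finset.mem_sdiff, Finset.mem_sdiff, mem_restr, mem_restr] at hx
      rw [Finset.mem_sdiff, Finset.mem_union, mem_restr, hX, Finset.mem_insert, Finset.mem_union]
      rcases hx with ⟨⟨h1, h2⟩, h3⟩ | ⟨⟨h1, h2⟩, h3⟩
      · have h4 : x ∉ S' i := fun hx =>
          Finset.disjoint_left.1 hd h2 ((hS' i).2.1 (mem_clauseVars_of_mem hx))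
        tauto
      · have h4 : x ∉ S i := fun hx =>
          Finset.disjoint_left.1 hd ((hS i).2.1 (mem_clauseVars_of_mem hx)) h2
        tauto
    have hcard : ∀ i, (A \ S i).card + (B \ S' i).card ≤ (D \ (S i ∪ S' i)).card := by
      intro i
      rw [← Finset.card_union_of_disjoint]
      · exact Finset.card_le_card (hsub i)
      · rw [Finset.disjoint_left]
        intro x hx hx'
        rw [Finset.mem_sdiff, mem_restr] at hx hx'
        exact Finset.disjoint_left.1 hd hx.1.2 hx'.1.2
    have hcard' : ∀ i s, (v, s) ∈ C →
        (A \ S i).card + (B \ S' i).card + 1 ≤ (D \ (S i ∪ S' i)).card := by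
      intro i s hs
      rw [← Finset.card_union_of_disjoint, ← Finset.card_insert_of_notMem (a := (v, s))]
      · refine Finset.card_le_card (Finset.insert_subset ?_ (hsub i))
        exact Finset.mem_sdiff.2 ⟨hDv s hs, hvS i s⟩
      · rw [Finset.mem_union, Finset.mem_sdiff, Finset.mem_sdiff, mem_restr, mem_restr]
        tauto
      · rw [Finset.disjoint_left]
        intro x hx hx'
        rw [Finset.mem_sdiff, mem_restr] at hx hx'
        exact Finset.disjoint_left.1 hd hx.1.2 hx'.1.2
    have hA : IsClause A := hC.subset (restr_subset _ _)
    have hB : IsClause B := hC.subset (restr_subset _ _)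
    have hAA : restr A (vars E) = A := by
      ext x; simp only [A, mem_restr]; tauto
    have hBB : restr B (vars E') = B := by
      ext x; simp only [B, mem_restr]; tauto
    have hl : (v, false) ∉ C →
        (Finset.univ.filter fun i => (A \ S i).card ≤ j).card ≤ 2 ^ j := fun hvC => by
      have := hb A hA (implies_restr_branch_left hC hEC hvC hv)
      rwa [hAA] at this
    have hr : (v, true) ∉ C →
        (Finset.univ.filter fun i => (B \ S' i).card ≤ j).card ≤ 2 ^ j := fun hvC => by
      have := hb' B hB (implies_restr_branch_right hC hEC hvC hv')
      rwa [hBB] at this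
    by_cases h1 : (v, false) ∈ C
    · refine le_trans (Finset.card_le_card fun i hi => ?_) ((hr (hC.notMem h1)).trans
        (Nat.pow_le_pow_right two_pos (Nat.le_succ j)))
      rw [Finset.mem_filter] at hi ⊢
      have := hcard' i _ h1
      have hi2 : (D \ (S i ∪ S' i)).card ≤ j + 1 := hi.2
      exact ⟨hi.1, by omega⟩
    by_cases h2 : (v, true) ∈ C
    · refine le_trans (Finset.card_le_card fun i hi => ?_) ((hl h1).trans
        (Nat.pow_le_pow_right two_pos (Nat.le_succ j)))
      rw [Finset.mem_filter] at hi ⊢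
      have := hcard' i _ h2
      have hi2 : (D \ (S i ∪ S' i)).card ≤ j + 1 := hi.2
      exact ⟨hi.1, by omega⟩
    · have : (Finset.univ.filter fun i => (D \ (S i ∪ S' i)).card ≤ j + 1) ⊆
          (Finset.univ.filter fun i => (A \ S i).card ≤ j) ∪
          (Finset.univ.filter fun i => (B \ S' i).card ≤ j) := by
        intro i hi
        rw [Finset.mem_filter] at hi
        rw [Finset.mem_union, Finset.mem_filter, Finset.mem_filter]
        have := hcard i
        have hi2 := hi.2
        by_cases hij : (A \ S i).card ≤ j
        · exact Or.inl ⟨hi.1, hij⟩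
        by_cases hij' : (B \ S' i).card ≤ j
        · exact Or.inr ⟨hi.1, hij'⟩
        omega
      refine (Finset.card_le_card this).trans ((Finset.card_union_le _ _).trans ?_)
      have := hl h1
      have := hr h2
      rw [pow_succ]
      omega

/-! ### Minimal implicates of branchings, and the counting bound -/

/-- The literal of `v` is indispensable: without it the clause would restrict to an implicate of
`E'`. That restriction is empty by disjointness, contradicting satisfiability of `E'`. -/
lemma isMinImplicate_branch_left {v : ℕ} {E E' : Finset (Finset Lit)} {C : Finset Lit}
    (h : IsMinImplicate E C) (hne : E.Nonempty) (hE' : ∃ a, Models a E')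
    (hv : v ∉ vars E) (hv' : v ∉ vars E') (hd : Disjoint (vars E) (vars E')) :
    IsMinImplicate (branch v E E') (insert (v, true) C) := by
  obtain ⟨h1, h2, h3, h4⟩ := h
  have hvC : v ∉ clauseVars C := fun h => hv (h2 h)
  have hcl : IsClause (insert (v, true) C) := isClause_insert h1 hvC
  refine ⟨hcl, ?_, h3.branch_left, fun D hD hED => Finset.Subset.antisymm hD ?_⟩
  · rw [clauseVars_insert, vars_branch v hne]
    exact Finset.insert_subset_insert _ (h2.trans Finset.subset_union_left)
  · have hDcl := hcl.subset hD
    have hf : (v, false) ∉ D := fun h => hcl.notMem (hD h) (Finset.mem_insert_self _ _)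
    have hDE := h4 _ (fun x hx => by
      rw [mem_restr] at hx
      rcases Finset.mem_insert.1 (hD hx.1) with rfl | h
      · exact absurd hx.2 hv
      · exact h) (implies_restr_branch_left hDcl hED hf hv)
    refine Finset.insert_subset ?_ (by rw [← hDE]; exact restr_subset _ _)
    by_contra ht
    obtain ⟨a, ha⟩ := hE'
    obtain ⟨x, hx, -⟩ := implies_restr_branch_right hDcl hED ht hv' a ha
    rw [mem_restr] at hx
    rcases Finset.mem_insert.1 (hD hx.1) with rfl | h
    · exact ht hx.1
    · exact Finset.disjoint_left.1 hd (h2 (mem_clauseVars_of_mem h)) hx.2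

/-- A subclause that is still an implicate does not mention `v`, so it restricts to an implicate on
either side; minimality on each side gives back `C` and `C'`. -/
lemma isMinImplicate_branch_union {v : ℕ} {E E' : Finset (Finset Lit)} {C C' : Finset Lit}
    (h : IsMinImplicate E C) (h' : IsMinImplicate E' C') (hne : E.Nonempty)
    (hv : v ∉ vars E) (hv' : v ∉ vars E') (hd : Disjoint (vars E) (vars E')) :
    IsMinImplicate (branch v E E') (C ∪ C') := by
  obtain ⟨h1, h2, h3, h4⟩ := h
  obtain ⟨h1', h2', h3', h4'⟩ := h'
  have hcl := isClause_union h1 h1' (hd.mono h2 h2')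
  refine ⟨hcl, ?_, h3.branch_union h3', fun D hD hED => Finset.Subset.antisymm hD ?_⟩
  · rw [vars_branch v hne, clauseVars_union]
    exact (Finset.union_subset_union h2 h2').trans (Finset.subset_insert _ _)
  · have hvD : ∀ s, (v, s) ∉ D := by
      intro s hs
      rcases Finset.mem_union.1 (hD hs) with h | h
      · exact hv (h2 (mem_clauseVars_of_mem h))
      · exact hv' (h2' (mem_clauseVars_of_mem h))
    have e1 := h4 _ (fun x hx => by
      rw [mem_restr] at hx
      rcases Finset.mem_union.1 (hD hx.1) with h | h
      · exact h
      · exact absurd (h2' (mem_clauseVars_of_mem h)) (Finset.disjoint_left.1 hd hx.2))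
      (implies_restr_branch_left (hcl.subset hD) hED (hvD _) hv)
    have e2 := h4' _ (fun x hx => by
      rw [mem_restr] at hx
      rcases Finset.mem_union.1 (hD hx.1) with h | h
      · exact absurd hx.2 (Finset.disjoint_left.1 hd (h2 (mem_clauseVars_of_mem h)))
      · exact h)
      (implies_restr_branch_right (hcl.subset hD) hED (hvD _) hv')
    refine Finset.union_subset ?_ ?_
    · rw [← e1]; exact restr_subset _ _
    · rw [← e2]; exact restr_subset _ _

/-- The lower bound for equivalent clause-sets of small width-hardness; the clause-set may have an
additional independent unit clause. -/
lemma HasSparseTriggers.le_card {k N : ℕ} {E F F' : Finset (Finset Lit)}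
    (h : HasSparseTriggers k N E) {v : ℕ} (hv : v ∉ vars E)
    (hFE : ∀ b, b v = true → (Models b F ↔ Models b E)) (hF : F ∈ CLS) (hsat : ∃ a, Models a F)
    (heq : Equivalent F' F) (hW : F' ∈ WC k) : N ≤ 2 ^ k * F'.card := by
  obtain ⟨S, hS, hb⟩ := h
  have hmod : ∀ a, Models a F' ↔ Models a F := fun a =>
    ⟨fun ha => heq.models hW.1 hF ha, fun ha => Equivalent.models hF hW.1 heq.symm ha⟩
  have htr : ∀ i, ∃ D ∈ F', (restr D (vars E) \ S i).card ≤ k ∧ (v, true) ∉ D := by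
    intro i
    obtain ⟨hcl, hvars, himp⟩ := hS i
    have hvS : v ∉ clauseVars (S i) := fun h => hv (hvars h)
    obtain ⟨a, ha⟩ := hsat
    -- The implicate is weakened by the negation of `v`. As a trigger does not clash with it, the
    -- trigger avoids `(v, true)`, and setting `v` to true then makes it an implicate about `E`.
    obtain ⟨D, hD, hk, hcl⟩ := exists_trigger hW ((hmod a).2 ha)
      (isClause_insert (x := (v, false)) hcl hvS) (by
        intro b hb
        cases hbv : b v
        · exact ⟨(v, false), Finset.mem_insert_self _ _, hbv⟩
        · exact (himp b ((hFE b hbv).1 ((hmod b).1 hb))).mono (Finset.subset_insert _ _))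
    refine ⟨D, hD, le_trans (Finset.card_le_card fun x hx => ?_) hk, fun hvD => ?_⟩
    · rw [Finset.mem_sdiff, mem_restr] at hx
      rw [Finset.mem_sdiff, Finset.mem_insert, not_or]
      refine ⟨hx.1.1, ?_, hx.2⟩
      rintro rfl
      exact hv hx.1.2
    · exact hcl _ hvD (by simp [Lit.compl])
  choose D hD hk hvD using htr
  -- Double counting for the map sending `i` to its trigger: each fibre has at most `2 ^ k`
  -- elements.
  have := Finset.card_le_mul_card_image_of_maps_to (s := Finset.univ) (t := F') (f := D)
    (fun i _ => hD i) (2 ^ k) (fun C hC => by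
      by_cases hvC : (v, true) ∈ C
      · have : (Finset.univ.filter fun i => D i = C) = ∅ := by
          rw [Finset.filter_eq_empty_iff]
          rintro i - rfl
          exact hvD i hvC
        rw [this]
        simp
      · have hCcl : IsClause C := hW.1 C hC
        have himp := implies_restr_of hCcl (fun a ha => ((hmod a).2 ha) C hC) hvC hv
          (fun b hb hE => (hFE b hb).2 hE)
        refine le_trans (Finset.card_le_card fun i hi => ?_)
          (hb _ (hCcl.subset (restr_subset _ _)) himp)
        rw [Finset.mem_filter] at hi ⊢
        refine ⟨hi.1, ?_⟩
        have e : restr (restr C (vars E)) (vars E) = restr C (vars E) := by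
          ext x; simp only [mem_restr]; tauto
        rw [e, ← hi.2]
        exact hk i)
  simpa using this

/-! ### Hardness of branchings -/

/-- All unsatisfiable instantiations of `E` have refutations of Horton-Strahler number at most
`j`. -/
def RefutableBy (j : ℕ) (E : Finset (Finset Lit)) : Prop :=
  ∀ φ : PartialAssignment, Unsatisfiable (φ.apply E) →
    ∃ T, Derives (φ.apply E) T ∅ ∧ T.shape.hts ≤ j

lemma RefutableBy.mem_UC {j : ℕ} {F : Finset (Finset Lit)} (h : RefutableBy j F) (hF : F ∈ CLS)
    (hsat : ∃ a, Models a F) : F ∈ UC j := by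
  refine ⟨hF, ?_⟩
  have hsat : ¬ Unsatisfiable F := not_not.2 (satisfiable_iff.2 hsat)
  rw [hardness, extendMeasure, if_neg hsat]
  split_ifs
  · exact zero_le
  · refine iSup_le fun φ => iSup_le fun hφ => ?_
    obtain ⟨T, hT, hj⟩ := h φ hφ
    exact (iInf_le_of_le T (iInf_le_of_le hT le_rfl)).trans (by exact_mod_cast hj)

lemma RefutableBy.mono {i j : ℕ} {E : Finset (Finset Lit)} (h : RefutableBy i E) (hij : i ≤ j) :
    RefutableBy j E := fun φ hφ =>
  let ⟨T, hT, hi⟩ := h φ hφ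
  ⟨T, hT, hi.trans hij⟩

lemma ResTree.IsFrom.mono {F G : Finset (Finset Lit)} (h : F ⊆ G) :
    ∀ {T : ResTree}, T.IsFrom F → T.IsFrom G
  | .ax _, hC => h hC
  | .res _ _ _, ⟨hS, hT, hx⟩ => ⟨hS.mono h, hT.mono h, hx⟩

lemma ResTree.clauseVars_concl_subset {F : Finset (Finset Lit)} :
    ∀ {T : ResTree}, T.IsFrom F → clauseVars T.concl ⊆ vars F
  | .ax _, hC => clauseVars_subset_vars hC
  | .res x S T, ⟨hS, hT, _⟩ => by
    refine (Finset.image_subset_image Finset.sdiff_subset).trans ?_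
    have := clauseVars_union S.concl T.concl
    rw [clauseVars] at this
    rw [this]
    exact Finset.union_subset (clauseVars_concl_subset hS) (clauseVars_concl_subset hT)

/-- Addition of a literal to all clauses of a resolution tree. -/
def ResTree.weaken (y : Lit) : ResTree → ResTree
  | .ax C => .ax (insert y C)
  | .res x S T => .res x (S.weaken y) (T.weaken y)

lemma ResTree.shape_weaken (y : Lit) : ∀ T : ResTree, (T.weaken y).shape = T.shape
  | .ax _ => rfl
  | .res _ S T => by simp [weaken, shape, shape_weaken y S, shape_weaken y T]

/-- Since the variable of `y` is new, adding `y` on both sides creates no clash, and `y` is never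
the literal resolved upon. -/
lemma ResTree.weaken_isFrom {F : Finset (Finset Lit)} {y : Lit} (hy : y.1 ∉ vars F) :
    ∀ T : ResTree, T.IsFrom F →
      (T.weaken y).IsFrom (F.image (insert y)) ∧ (T.weaken y).concl = insert y T.concl
  | .ax C, hC => ⟨Finset.mem_image_of_mem _ hC, rfl⟩
  | .res x S T, ⟨hS, hT, hx⟩ => by
    obtain ⟨hS1, hS2⟩ := weaken_isFrom hy S hS
    obtain ⟨hT1, hT2⟩ := weaken_isFrom hy T hT
    have hxm : x ∈ S.concl ∩ complSet T.concl := by rw [hx]; simp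
    rw [Finset.mem_inter, mem_complSet] at hxm
    have hnS : ∀ z : Lit, z.1 = y.1 → z ∉ S.concl := fun z hz h =>
      hy (hz ▸ clauseVars_concl_subset hS (mem_clauseVars_of_mem h))
    have hnT : ∀ z : Lit, z.1 = y.1 → z ∉ T.concl := fun z hz h =>
      hy (hz ▸ clauseVars_concl_subset hT (mem_clauseVars_of_mem h))
    refine ⟨⟨hS1, hT1, ?_⟩, ?_⟩
    · rw [← hx, hS2, hT2]
      ext z
      rw [Finset.mem_inter, Finset.mem_inter, mem_complSet, mem_complSet, Finset.mem_insert,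
        Finset.mem_insert]
      constructor
      · rintro ⟨rfl | h1, h2 | h2⟩
        · exact absurd h2 (Lit.compl_ne _)
        · exact absurd h2 (hnT _ rfl)
        · exact absurd h1 (hnS _ (by rw [← h2]; rfl))
        · exact ⟨h1, h2⟩
      · rintro ⟨h1, h2⟩
        exact ⟨Or.inr h1, Or.inr h2⟩
    · rw [weaken, concl, hS2, hT2, concl]
      ext z
      simp only [Finset.mem_sdiff, Finset.mem_union, Finset.mem_insert, Finset.mem_singleton]
      constructor
      · tauto
      · rintro (rfl | h)
        · refine ⟨Or.inl (Or.inl rfl), ?_⟩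
          rintro (rfl | rfl)
          · exact hnS _ rfl hxm.1
          · exact hnT _ rfl hxm.2
        · tauto

/-- The Horton-Strahler number of a tree, given those of its two subtrees. -/
def joinHts (a b : ℕ) : ℕ := if a = b then 1 + max a b else max a b

lemma joinHts_mono {a b a' b' : ℕ} (ha : a ≤ a') (hb : b ≤ b') : joinHts a b ≤ joinHts a' b' := by
  unfold joinHts
  split_ifs <;> omega

lemma le_joinHts_left (a b : ℕ) : a ≤ joinHts a b := by
  unfold joinHts
  split_ifs <;> omega

lemma le_joinHts_right (a b : ℕ) : b ≤ joinHts a b := by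
  unfold joinHts
  split_ifs <;> omega

/-- Passing to a clause-set whose models include those of `E` under a condition on `φ`. -/
lemma RefutableBy.transfer {j : ℕ} {E F : Finset (Finset Lit)} (h : RefutableBy j E)
    {φ : PartialAssignment} (hφ : Unsatisfiable (φ.apply F)) (v : ℕ) (s : Bool)
    (hv : v ∉ vars E) (hs : φ.val v ≠ some (!s)) (hFE : ∀ b, b v = s → Models b E → Models b F) :
    ∃ T, Derives (φ.apply E) T ∅ ∧ T.shape.hts ≤ j := by
  refine h φ ?_
  rw [unsatisfiable_apply_iff] at *
  intro a ha haE
  -- Changing `v` to `s` keeps the assignment an extension of `φ`, as `φ` does not set `v` to `!s`,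
  -- and keeps it a model of `E`, where `v` does not occur.
  refine hφ (Function.update a v s) ?_ (hFE _ (by simp) (haE.congr fun w hw => ?_))
  · intro w b hw
    by_cases hwv : w = v
    · subst hwv
      rw [Function.update_self]
      rw [hw] at hs
      cases s <;> cases b <;> simp_all
    · rw [Function.update_of_ne hwv]
      exact ha w b hw
  · rw [Function.update_of_ne]
    rintro rfl
    exact hv hw

lemma Derives.mono {F G : Finset (Finset Lit)} (h : F ⊆ G) {T : ResTree} {C : Finset Lit}
    (hT : Derives F T C) : Derives G T C := ⟨hT.1.mono h, hT.2⟩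

lemma apply_image_insert_of_false {φ : PartialAssignment} {x : Lit} (hx : φ.lit x = some false)
    {E : Finset (Finset Lit)} : φ.apply E ⊆ φ.apply (E.image (insert x)) := by
  intro D hD
  rw [PartialAssignment.mem_apply] at *
  obtain ⟨C, hC, hs, rfl⟩ := hD
  refine ⟨insert x C, Finset.mem_image_of_mem _ hC, ?_, ?_⟩
  · intro y hy
    rcases Finset.mem_insert.1 hy with rfl | hy
    · simp [hx]
    · exact hs y hy
  · rw [Finset.filter_insert, if_neg (by simp [hx])]

lemma image_insert_apply_of_none {φ : PartialAssignment} {x : Lit} (hx : φ.lit x = none)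
    {E : Finset (Finset Lit)} : (φ.apply E).image (insert x) ⊆ φ.apply (E.image (insert x)) := by
  intro D hD
  obtain ⟨D', hD', rfl⟩ := Finset.mem_image.1 hD
  obtain ⟨C, hC, hs, rfl⟩ := PartialAssignment.mem_apply.1 hD'
  rw [PartialAssignment.mem_apply]
  refine ⟨insert x C, Finset.mem_image_of_mem _ hC, ?_, ?_⟩
  · intro y hy
    rcases Finset.mem_insert.1 hy with rfl | hy
    · simp [hx]
    · exact hs y hy
  · rw [Finset.filter_insert, if_pos (by simp [hx])]

/-- If `φ` leaves `v` unassigned, both sides are refuted, the refutations are weakened by `v` and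
its complement, and one resolution on `v` joins them. If `φ` assigns `v`, the side whose literal of
`v` is falsified already supplies a refutation. -/
lemma RefutableBy.branch {i j v : ℕ} {E E' : Finset (Finset Lit)} (h : RefutableBy i E)
    (h' : RefutableBy j E') (hv : v ∉ vars E) (hv' : v ∉ vars E') :
    RefutableBy (joinHts i j) (branch v E E') := by
  intro φ hφ
  have hl : φ.val v ≠ some true → ∃ T, Derives (φ.apply E) T ∅ ∧ T.shape.hts ≤ i := fun hs =>
    h.transfer hφ v false hv hs fun b hb hE => models_branch.2
      ⟨fun _ => hE, fun h => by simp [hb] at h⟩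
  have hr : φ.val v ≠ some false → ∃ T, Derives (φ.apply E') T ∅ ∧ T.shape.hts ≤ j := fun hs =>
    h'.transfer hφ v true hv' hs fun b hb hE => models_branch.2
      ⟨fun h => by simp [hb] at h, fun _ => hE⟩
  have hsl : φ.apply (E.image (insert (v, true))) ⊆ φ.apply (ClauseSets.branch v E E') :=
    φ.apply_mono Finset.subset_union_left
  have hsr : φ.apply (E'.image (insert (v, false))) ⊆ φ.apply (ClauseSets.branch v E E') :=
    φ.apply_mono Finset.subset_union_right
  rcases hval : φ.val v with _ | b
  · obtain ⟨T, hT, hTi⟩ := hl (by simp [hval])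
    obtain ⟨T', hT', hTj⟩ := hr (by simp [hval])
    have hn : ∀ s, φ.lit (v, s) = none := fun s => by simp [PartialAssignment.lit, hval]
    obtain ⟨a1, a2⟩ := ResTree.weaken_isFrom (y := (v, true))
      (fun h => hv (φ.vars_apply_subset E h)) T hT.1
    obtain ⟨b1, b2⟩ := ResTree.weaken_isFrom (y := (v, false))
      (fun h => hv' (φ.vars_apply_subset E' h)) T' hT'.1
    rw [hT.2] at a2
    rw [hT'.2] at b2
    refine ⟨.res (v, true) (T.weaken (v, true)) (T'.weaken (v, false)), ⟨⟨?_, ?_, ?_⟩, ?_⟩, ?_⟩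
    · exact a1.mono ((image_insert_apply_of_none (hn _)).trans hsl)
    · exact b1.mono ((image_insert_apply_of_none (hn _)).trans hsr)
    · rw [a2, b2]
      ext z
      rw [Finset.mem_inter, mem_complSet]
      rcases z with ⟨w, c⟩
      cases c <;> simp [Lit.compl]
    · rw [ResTree.concl, a2, b2]
      ext z
      simp [Lit.compl]
    · rw [ResTree.shape, FullTree.hts, ResTree.shape_weaken, ResTree.shape_weaken]
      exact joinHts_mono hTi hTj
  · cases b
    · obtain ⟨T, hT, hTi⟩ := hl (by simp [hval])
      exact ⟨T, hT.mono ((apply_image_insert_of_false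
        (by simp [PartialAssignment.lit, hval])).trans hsl), hTi.trans (le_joinHts_left _ _)⟩
    · obtain ⟨T, hT, hTj⟩ := hr (by simp [hval])
      exact ⟨T, hT.mono ((apply_image_insert_of_false
        (by simp [PartialAssignment.lit, hval])).trans hsr), hTj.trans (le_joinHts_right _ _)⟩

/-! ### Extremal trees -/

/-- The extremal tree of Horton-Strahler number `k` and height `h`, for `k ≤ h`. -/
def extremalTree : ℕ → ℕ → FullTree
  | 0, _ => .leaf
  | _ + 1, 0 => .leaf
  | k + 1, h + 1 => .node (extremalTree k h) (extremalTree (k + 1) h)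

/-- The number of leaves. -/
def FullTree.numLeaves : FullTree → ℕ
  | .leaf => 1
  | .node l r => l.numLeaves + r.numLeaves

/-- All nodes of depth `j` exist, and are roots of subtrees of height at least `m`. -/
def FullTree.DeepBelow : ℕ → ℕ → FullTree → Prop
  | 0, m, T => m ≤ T.height
  | _ + 1, _, .leaf => False
  | j + 1, m, .node l r => l.DeepBelow j m ∧ r.DeepBelow j m

lemma FullTree.numNodes_add_one : ∀ T : FullTree, T.numNodes + 1 = 2 * T.numLeaves
  | .leaf => rfl
  | .node l r => by
    have := numNodes_add_one l
    have := numNodes_add_one r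
    simp only [numNodes, numLeaves]
    omega

lemma hts_extremalTree (k h : ℕ) : (extremalTree k h).hts = min k h := by
  induction h generalizing k with
  | zero => cases k <;> simp [extremalTree, FullTree.hts]
  | succ h ih =>
    cases k with
    | zero => simp [extremalTree, FullTree.hts]
    | succ k =>
      rw [extremalTree, FullTree.hts, ih, ih]
      split_ifs <;> omega

lemma height_extremalTree (k h : ℕ) : (extremalTree (k + 1) h).height = h := by
  induction h generalizing k with
  | zero => simp [extremalTree, FullTree.height]
  | succ h ih =>
    rw [extremalTree, FullTree.height, ih]
    cases k with
    | zero => simp [extremalTree, FullTree.height]; omega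
    | succ k => rw [ih]; omega

lemma height_extremalTree_le (k h : ℕ) : (extremalTree k h).height ≤ h := by
  cases k with
  | zero => simp [extremalTree, FullTree.height]
  | succ k => exact (height_extremalTree k h).le

/-- At the root, one of the subtrees has Horton-Strahler number at most `k`, since otherwise the
number would grow. The bounds for the two subtrees add up, so equality for the whole tree forces
equality in both; this yields the uniqueness. -/
lemma numNodes_le_extremalTree (T : FullTree) : ∀ k h : ℕ, T.hts ≤ k → T.height ≤ h →
    T.numNodes ≤ (extremalTree k h).numNodes ∧
      (T.numNodes = (extremalTree k h).numNodes → SwapEquiv (extremalTree k h) T) := by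
  have hpos : ∀ T : FullTree, 1 ≤ T.numNodes := by
    intro T
    cases T <;> simp only [FullTree.numNodes] <;> omega
  induction T with
  | leaf =>
    intro k h _ _
    refine ⟨hpos _, fun heq => ?_⟩
    cases k with
    | zero => rw [extremalTree]; exact SwapEquiv.leaf
    | succ k =>
      cases h with
      | zero => exact SwapEquiv.leaf
      | succ h =>
        rw [extremalTree, FullTree.numNodes, FullTree.numNodes] at heq
        have := hpos (extremalTree k h)
        omega
  | node l r ihl ihr =>
    intro k h hk hh
    rw [FullTree.hts] at hk
    rw [FullTree.height] at hh
    cases k with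
    | zero => split_ifs at hk <;> omega
    | succ k =>
      cases h with
      | zero => omega
      | succ h =>
        rw [extremalTree, FullTree.numNodes, FullTree.numNodes]
        have hcase : (l.hts ≤ k ∧ r.hts ≤ k + 1) ∨ (r.hts ≤ k ∧ l.hts ≤ k + 1) := by
          split_ifs at hk <;> omega
        rcases hcase with ⟨h1, h2⟩ | ⟨h1, h2⟩
        · have a := ihl k h h1 (by omega)
          have b := ihr (k + 1) h h2 (by omega)
          refine ⟨by omega, fun heq => SwapEquiv.node (a.2 ?_) (b.2 ?_)⟩ <;> omega
        · have a := ihr k h h1 (by omega)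
          have b := ihl (k + 1) h h2 (by omega)
          refine ⟨by omega, fun heq => SwapEquiv.swap (a.2 ?_) (b.2 ?_)⟩ <;> omega

lemma extremalTree_mem {k h : ℕ} (hk : k + 1 ≤ h) :
    extremalTree (k + 1) h ∈ extremalTrees (k + 1) h :=
  ⟨by rw [hts_extremalTree]; omega, height_extremalTree k h,
    fun T h1 h2 => (numNodes_le_extremalTree T _ _ h1 h2).1⟩

lemma numNodes_eq_of_mem_extremalTrees {k h : ℕ} {T : FullTree} (hT : T ∈ extremalTrees k h) :
    T.numNodes = (extremalTree k h).numNodes :=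
  le_antisymm (numNodes_le_extremalTree T _ _ hT.1.le hT.2.1.le).1
    (hT.2.2 _ (by rw [hts_extremalTree]; omega) (height_extremalTree_le k h))

lemma swapEquiv_of_mem_extremalTrees {k h : ℕ} {T : FullTree} (hT : T ∈ extremalTrees k h) :
    SwapEquiv (extremalTree k h) T :=
  (numNodes_le_extremalTree T _ _ hT.1.le hT.2.1.le).2 (numNodes_eq_of_mem_extremalTrees hT)

lemma SwapEquiv.height_eq {T T' : FullTree} (h : SwapEquiv T T') : T.height = T'.height := by
  induction h with
  | leaf => rfl
  | node _ _ h1 h2 => simp only [FullTree.height, h1, h2]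
  | swap _ _ h1 h2 => simp only [FullTree.height, h1, h2, max_comm]

lemma SwapEquiv.deepBelow {T T' : FullTree} (h : SwapEquiv T T') :
    ∀ {j m : ℕ}, T.DeepBelow j m → T'.DeepBelow j m := by
  induction h with
  | leaf => exact id
  | node h h' h1 h2 =>
    intro j m hd
    cases j with
    | zero =>
      rw [FullTree.DeepBelow] at *
      rwa [← (SwapEquiv.node h h').height_eq]
    | succ j => exact ⟨h1 hd.1, h2 hd.2⟩
  | swap h h' h1 h2 =>
    intro j m hd
    cases j with
    | zero =>
      rw [FullTree.DeepBelow] at *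
      rwa [← (SwapEquiv.swap h h').height_eq]
    | succ j => exact ⟨h2 hd.2, h1 hd.1⟩

/-- Each step down lowers the first index by at most one. Within `j ≤ k` steps it remains positive,
so all subtrees reached keep the full height allowed by their depth. -/
lemma deepBelow_extremalTree {j k h : ℕ} (hk : j ≤ k) (hh : j ≤ h) :
    (extremalTree (k + 1) h).DeepBelow j (h - j) := by
  induction j generalizing k h with
  | zero => exact (height_extremalTree k h).ge
  | succ j ih =>
    obtain ⟨k, rfl⟩ : ∃ k', k = k' + 1 := ⟨k - 1, by omega⟩
    obtain ⟨h, rfl⟩ : ∃ h', h = h' + 1 := ⟨h - 1, by omega⟩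
    rw [extremalTree, Nat.add_sub_add_right]
    exact ⟨ih (by omega) (by omega), ih (by omega) (by omega)⟩

lemma numLeaves_extremalTree_le (k h : ℕ) : (extremalTree k h).numLeaves ≤ (h + 1) ^ k := by
  induction h generalizing k with
  | zero => cases k <;> simp [extremalTree, FullTree.numLeaves]
  | succ h ih =>
    cases k with
    | zero => simp [extremalTree, FullTree.numLeaves]
    | succ k =>
      rw [extremalTree, FullTree.numLeaves]
      have h1 := ih k
      have h2 := ih (k + 1)
      have h3 : (h + 1) ^ k ≤ (h + 1 + 1) ^ k := Nat.pow_le_pow_left (by omega) k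
      rw [pow_succ] at h2 ⊢
      nlinarith

/-- The recursion of the extremal trees is Pascal's rule, with boundary values at least those of the
binomial coefficients. -/
lemma choose_le_numLeaves_extremalTree (k h : ℕ) :
    h.choose k ≤ (extremalTree k h).numLeaves := by
  induction h generalizing k with
  | zero => cases k <;> simp [extremalTree, FullTree.numLeaves]
  | succ h ih =>
    cases k with
    | zero => simp [extremalTree, FullTree.numLeaves]
    | succ k =>
      rw [extremalTree, FullTree.numLeaves, Nat.choose_succ_succ]
      exact Nat.add_le_add (ih k) (ih (k + 1))

/-! ### Doped trees -/

/-- `E` is the doped clause-set of some labelling of the tree `T`. -/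
inductive IsDopedTree : FullTree → Finset (Finset Lit) → Prop
  | leaf (w : ℕ) : IsDopedTree .leaf {{(w, true)}}
  | node {l r : FullTree} {E E' : Finset (Finset Lit)} (v : ℕ) :
      IsDopedTree l E → IsDopedTree r E' → v ∉ vars E → v ∉ vars E' →
      Disjoint (vars E) (vars E') → IsDopedTree (.node l r) (branch v E E')

lemma vars_singleton (C : Finset Lit) : vars {C} = clauseVars C := by
  simp [vars]

lemma isClause_singleton (x : Lit) : IsClause {x} := by
  rw [isClause_iff]
  intro y hy hy'
  rw [Finset.mem_singleton] at hy hy'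
  subst hy
  exact Lit.compl_ne _ hy'

lemma IsDopedTree.nonempty {T : FullTree} {E : Finset (Finset Lit)} (h : IsDopedTree T E) :
    E.Nonempty := by
  induction h with
  | leaf w => exact Finset.singleton_nonempty _
  | node v _ _ _ _ _ h1 _ => exact branch_nonempty v h1

lemma IsDopedTree.mem_CLS {T : FullTree} {E : Finset (Finset Lit)} (h : IsDopedTree T E) :
    E ∈ CLS := by
  induction h with
  | leaf w =>
    intro C hC
    rw [Finset.mem_singleton] at hC
    subst hC
    exact isClause_singleton _
  | node v _ _ hv hv' _ h1 h2 => exact branch_mem_CLS h1 h2 hv hv'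

lemma IsDopedTree.satisfiable {T : FullTree} {E : Finset (Finset Lit)} (h : IsDopedTree T E) :
    ∃ a, Models a E := by
  induction h with
  | leaf w =>
    refine ⟨fun _ => true, fun C hC => ?_⟩
    rw [Finset.mem_singleton] at hC
    subst hC
    exact ⟨_, Finset.mem_singleton_self _, rfl⟩
  | node v _ _ hv hv' _ h1 h2 =>
    obtain ⟨a, ha⟩ := h2
    refine ⟨Function.update a v true, models_branch.2 ⟨fun h => by simp at h, fun _ => ?_⟩⟩
    refine ha.congr fun w hw => ?_
    rw [Function.update_of_ne]
    rintro rfl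
    exact hv' hw

lemma IsDopedTree.numVars_eq {T : FullTree} {E : Finset (Finset Lit)} (h : IsDopedTree T E) :
    numVars E = T.numNodes := by
  induction h with
  | leaf w => simp [numVars, vars, clauseVars, FullTree.numNodes]
  | node v hE _ hv hv' hd h1 h2 =>
    rw [numVars] at *
    rw [vars_branch v hE.nonempty, Finset.card_insert_of_notMem (by simp [hv, hv']),
      Finset.card_union_of_disjoint hd, h1, h2, FullTree.numNodes]
    omega

lemma insert_injOn {x : Lit} {E : Finset (Finset Lit)} (hx : x.1 ∉ vars E) :
    Set.InjOn (insert x) (E : Set (Finset Lit)) := by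
  have : ∀ C ∈ E, x ∉ C := fun C hC h =>
    hx (clauseVars_subset_vars hC (mem_clauseVars_of_mem h))
  intro C hC D hD h
  rw [← Finset.erase_insert (this C hC), ← Finset.erase_insert (this D hD), h]

lemma IsDopedTree.numClauses_eq {T : FullTree} {E : Finset (Finset Lit)} (h : IsDopedTree T E) :
    numClauses E = T.numLeaves := by
  induction h with
  | leaf w => simp [numClauses, FullTree.numLeaves]
  | @node l r E E' v hE hE' hv hv' hd h1 h2 =>
    rw [numClauses] at *
    rw [FullTree.numLeaves, ← h1, ← h2, branch, Finset.card_union_of_disjoint,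
      Finset.card_image_of_injOn (insert_injOn hv), Finset.card_image_of_injOn (insert_injOn hv')]
    rw [Finset.disjoint_left]
    intro C hC hC'
    obtain ⟨D, hD, rfl⟩ := Finset.mem_image.1 hC
    obtain ⟨D', hD', h⟩ := Finset.mem_image.1 hC'
    have : (v, false) ∈ insert (v, true) D := by rw [← h]; exact Finset.mem_insert_self _ _
    rw [Finset.mem_insert] at this
    rcases this with h | h
    · simp at h
    · exact hv (clauseVars_subset_vars hD (mem_clauseVars_of_mem h))

/-- If the unit clause is falsified, the empty clause is itself an axiom. -/
lemma refutableBy_of_not_false {j : ℕ} {E : Finset (Finset Lit)} {x : Lit} (hx : {x} ∈ E)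
    (h : ∀ φ : PartialAssignment, φ.lit x ≠ some false → Unsatisfiable (φ.apply E) →
      ∃ T, Derives (φ.apply E) T ∅ ∧ T.shape.hts ≤ j) : RefutableBy j E := by
  intro φ hφ
  by_cases hxφ : φ.lit x = some false
  · refine ⟨.ax ∅, ⟨PartialAssignment.mem_apply.2 ⟨{x}, hx, ?_, ?_⟩, rfl⟩, Nat.zero_le _⟩
    · simp [hxφ]
    · simp [hxφ]
  · exact h φ hxφ hφ

lemma IsDopedTree.refutableBy {T : FullTree} {E : Finset (Finset Lit)} (h : IsDopedTree T E) :
    RefutableBy T.hts E := by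
  induction h with
  | leaf w =>
    refine refutableBy_of_not_false (Finset.mem_singleton_self _) fun φ hφ hun => ?_
    rw [unsatisfiable_apply_iff] at hun
    refine absurd ?_ (hun (fun v => (φ.val v).getD true) fun v b hv => by simp [hv])
    intro C hC
    rw [Finset.mem_singleton] at hC
    subst hC
    refine ⟨_, Finset.mem_singleton_self _, ?_⟩
    rw [Ne, PartialAssignment.lit_eq_some] at hφ
    rcases hv : φ.val w with _ | b
    · simp [hv]
    · cases b <;> simp_all
  | node v _ _ hv hv' _ h1 h2 => exact h1.branch h2 hv hv'

lemma isMinImplicate_branch_right {v : ℕ} {E E' : Finset (Finset Lit)} {C : Finset Lit}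
    (h : IsMinImplicate E' C) (hne : E.Nonempty) (hE : ∃ a, Models a E)
    (hv : v ∉ vars E) (hv' : v ∉ vars E') (hd : Disjoint (vars E) (vars E')) :
    IsMinImplicate (branch v E E') (insert (v, false) C) := by
  obtain ⟨h1, h2, h3, h4⟩ := h
  have hvC : v ∉ clauseVars C := fun h => hv' (h2 h)
  have hcl : IsClause (insert (v, false) C) := isClause_insert h1 hvC
  refine ⟨hcl, ?_, ?_, fun D hD hED => Finset.Subset.antisymm hD ?_⟩
  · rw [clauseVars_insert, vars_branch v hne]
    exact Finset.insert_subset_insert _ (h2.trans Finset.subset_union_right)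
  · intro a ha
    rw [models_branch] at ha
    cases hav : a v
    · exact ⟨(v, false), Finset.mem_insert_self _ _, hav⟩
    · exact (h3 a (ha.2 hav)).mono (Finset.subset_insert _ _)
  · have hDcl := hcl.subset hD
    have hf : (v, true) ∉ D := fun h => hcl.notMem (hD h) (Finset.mem_insert_self _ _)
    have hDE := h4 _ (fun x hx => by
      rw [mem_restr] at hx
      rcases Finset.mem_insert.1 (hD hx.1) with rfl | h
      · exact absurd hx.2 hv'
      · exact h) (implies_restr_branch_right hDcl hED hf hv')
    refine Finset.insert_subset ?_ (by rw [← hDE]; exact restr_subset _ _)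
    by_contra ht
    obtain ⟨a, ha⟩ := hE
    obtain ⟨x, hx, -⟩ := implies_restr_branch_left hDcl hED ht hv a ha
    rw [mem_restr] at hx
    rcases Finset.mem_insert.1 (hD hx.1) with rfl | h
    · exact ht hx.1
    · exact Finset.disjoint_left.1 hd hx.2 (h2 (mem_clauseVars_of_mem h))

lemma union_injOn {A : Finset (Finset Lit)} {X : Finset ℕ} {C : Finset Lit}
    (hA : ∀ D ∈ A, clauseVars D ⊆ X) (hC : Disjoint X (clauseVars C)) :
    Set.InjOn (fun D => D ∪ C) (A : Set (Finset Lit)) := by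
  have key : ∀ D ∈ A, restr (D ∪ C) X = D := by
    intro D hD
    ext x
    rw [mem_restr, Finset.mem_union]
    constructor
    · rintro ⟨h | h, hx⟩
      · exact h
      · exact absurd (mem_clauseVars_of_mem h) (Finset.disjoint_left.1 hC hx)
    · exact fun h => ⟨Or.inl h, hA D hD (mem_clauseVars_of_mem h)⟩
  intro D hD D' hD' h
  have h' : D ∪ C = D' ∪ C := h
  rw [← key D hD, ← key D' hD', h']

lemma card_insert_union_images {A : Finset (Finset Lit)} {X : Finset ℕ} {C : Finset Lit} {x : Lit}
    (hA : ∀ D ∈ A, clauseVars D ⊆ X) (hC : Disjoint X (clauseVars C)) (hx : x.1 ∉ X)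
    (hxC : x.1 ∉ clauseVars C) :
    (A.image (insert x) ∪ A.image (fun D => D ∪ C)).card = 2 * A.card := by
  rw [Finset.card_union_of_disjoint, Finset.card_image_of_injOn,
    Finset.card_image_of_injOn (union_injOn hA hC), two_mul]
  · refine insert_injOn fun h => ?_
    obtain ⟨D, hD, h⟩ := mem_vars.1 h
    exact hx (hA D hD h)
  · rw [Finset.disjoint_left]
    intro B hB hB'
    obtain ⟨D, hD, rfl⟩ := Finset.mem_image.1 hB
    obtain ⟨D', hD', h⟩ := Finset.mem_image.1 hB'
    have hx' : x ∈ D' ∪ C := by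
      have h' : D' ∪ C = insert x D := h
      rw [h']
      exact Finset.mem_insert_self _ _
    rcases Finset.mem_union.1 hx' with h | h
    · exact hx (hA D' hD' (mem_clauseVars_of_mem h))
    · exact hxC (mem_clauseVars_of_mem h)

/-- Each node on a longest path doubles the number: a minimal implicate of the higher side is
extended either by the literal of the root variable or by one fixed minimal implicate of the other
side. -/
lemma IsDopedTree.exists_minImplicates {T : FullTree} {E : Finset (Finset Lit)}
    (h : IsDopedTree T E) : ∀ m ≤ T.height, ∃ A : Finset (Finset Lit),
      2 ^ m ≤ A.card ∧ ∀ C ∈ A, IsMinImplicate E C := by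
  induction h with
  | leaf w =>
    intro m hm
    rw [FullTree.height, Nat.le_zero] at hm
    subst hm
    refine ⟨{{(w, true)}}, by simp, fun C hC => ?_⟩
    rw [Finset.mem_singleton] at hC
    subst hC
    refine ⟨isClause_singleton _, (vars_singleton _).ge,
      fun a ha => ha _ (Finset.mem_singleton_self _), fun D hD hED => ?_⟩
    rcases Finset.subset_singleton_iff.1 hD with rfl | rfl
    · obtain ⟨x, hx, -⟩ := hED (fun _ => true) fun C hC => by
        rw [Finset.mem_singleton] at hC
        subst hC
        exact ⟨_, Finset.mem_singleton_self _, rfl⟩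
      simp at hx
    · rfl
  | @node l r E E' v hE hE' hv hv' hd h1 h2 =>
    intro m hm
    rw [FullTree.height] at hm
    obtain ⟨A, hA, hAE⟩ := h1 0 (Nat.zero_le _)
    obtain ⟨A', hA', hAE'⟩ := h2 0 (Nat.zero_le _)
    obtain ⟨C, hC⟩ : A.Nonempty := Finset.card_pos.1 (by simpa using hA)
    obtain ⟨C', hC'⟩ : A'.Nonempty := Finset.card_pos.1 (by simpa using hA')
    have hmin := hAE C hC
    have hmin' := hAE' C' hC'
    cases m with
    | zero =>
      refine ⟨{C ∪ C'}, by simp, fun B hB => ?_⟩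
      rw [Finset.mem_singleton] at hB
      subst hB
      exact isMinImplicate_branch_union hmin hmin' hE.nonempty hv hv' hd
    | succ m =>
      have hm' : m ≤ l.height ∨ m ≤ r.height := by omega
      rcases hm' with hm' | hm'
      · obtain ⟨B, hB, hBE⟩ := h1 m hm'
        refine ⟨B.image (insert (v, true)) ∪ B.image (fun D => D ∪ C'), ?_, fun D hD => ?_⟩
        · rw [card_insert_union_images (X := vars E) (fun D hD => (hBE D hD).2.1)
            (hd.mono_right hmin'.2.1) hv (fun h => hv' (hmin'.2.1 h)), pow_succ]
          omega
        · rcases Finset.mem_union.1 hD with hD | hD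
          · obtain ⟨D, hDB, rfl⟩ := Finset.mem_image.1 hD
            exact isMinImplicate_branch_left (hBE D hDB) hE.nonempty hE'.satisfiable hv hv' hd
          · obtain ⟨D, hDB, rfl⟩ := Finset.mem_image.1 hD
            exact isMinImplicate_branch_union (hBE D hDB) hmin' hE.nonempty hv hv' hd
      · obtain ⟨B, hB, hBE⟩ := h2 m hm'
        refine ⟨B.image (insert (v, false)) ∪ B.image (fun D => D ∪ C), ?_, fun D hD => ?_⟩
        · rw [card_insert_union_images (X := vars E') (fun D hD => (hBE D hD).2.1)
            (hd.symm.mono_right hmin.2.1) hv' (fun h => hv (hmin.2.1 h)), pow_succ]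
          omega
        · rcases Finset.mem_union.1 hD with hD | hD
          · obtain ⟨D, hDB, rfl⟩ := Finset.mem_image.1 hD
            exact isMinImplicate_branch_right (hBE D hDB) hE.nonempty hE.satisfiable hv hv' hd
          · obtain ⟨D, hDB, rfl⟩ := Finset.mem_image.1 hD
            rw [Finset.union_comm]
            exact isMinImplicate_branch_union hmin (hBE D hDB) hE.nonempty hv hv' hd

/-- The top `j` levels raise the excess by branching; below them the subtrees contribute their
minimal implicates as the base case. -/
lemma IsDopedTree.hasSparseTriggers {j m : ℕ} {T : FullTree} {E : Finset (Finset Lit)}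
    (h : IsDopedTree T E) (hT : T.DeepBelow j m) : HasSparseTriggers j (2 ^ m) E := by
  induction j generalizing T E with
  | zero =>
    rw [FullTree.DeepBelow] at hT
    obtain ⟨A, hA, hAE⟩ := h.exists_minImplicates m hT
    exact hasSparseTriggers_zero hA hAE
  | succ j ih =>
    cases h with
    | leaf w => exact hT.elim
    | node v h1 h2 hv hv' hd =>
      exact hasSparseTriggers_branch (ih h1 hT.1) (ih h2 hT.2) h1.nonempty hv hv' hd

/-! ### From labelled trees to doped trees -/

lemma LTree.smu_node (v : ℕ) (l r : LTree) : (LTree.node v l r).smu = branch v l.smu r.smu := rfl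

lemma LTree.vars_smu_subset : ∀ T : LTree, vars T.smu ⊆ T.labels.toFinset
  | .leaf => by simp [LTree.smu, vars, clauseVars]
  | .node v l r => by
    rw [LTree.smu_node]
    refine (vars_branch_subset _ _ _).trans ?_
    rw [LTree.labels, List.toFinset_cons, List.toFinset_append]
    exact Finset.insert_subset_insert _
      (Finset.union_subset_union l.vars_smu_subset r.vars_smu_subset)

lemma LTree.smu_nonempty : ∀ T : LTree, T.smu.Nonempty
  | .leaf => Finset.singleton_nonempty _
  | .node v l _ => branch_nonempty v l.smu_nonempty

/-- Doping commutes with branching, so the doped clause-set can be analysed recursively, with the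
doping map pulled back to each side. -/
lemma doping_branch (u : Finset Lit → ℕ) (v : ℕ) (E E' : Finset (Finset Lit)) :
    doping u (branch v E E') = branch v (doping (fun C => u (insert (v, true) C)) E)
      (doping (fun C => u (insert (v, false) C)) E') := by
  simp only [doping, branch, Finset.image_union, Finset.image_image]
  congr 2 <;>
  · funext C
    exact Finset.insert_comm _ _ _

lemma vars_doping_subset (u : Finset Lit → ℕ) (E : Finset (Finset Lit)) :
    vars (doping u E) ⊆ vars E ∪ E.image u := by
  intro w hw
  obtain ⟨C, hC, hw⟩ := mem_vars.1 hw
  obtain ⟨D, hD, rfl⟩ := Finset.mem_image.1 hC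
  rw [clauseVars_insert, Finset.mem_insert] at hw
  rw [Finset.mem_union]
  rcases hw with rfl | hw
  · exact Or.inr (Finset.mem_image_of_mem _ hD)
  · exact Or.inl (clauseVars_subset_vars hD hw)

lemma isDopingMap_insert {u : Finset Lit → ℕ} {v : ℕ} {s : Bool} {E F : Finset (Finset Lit)}
    (h : IsDopingMap F u) (hEF : ∀ C ∈ E, insert (v, s) C ∈ F) (hE : vars E ⊆ vars F)
    (hv : v ∉ vars E) : IsDopingMap E (fun C => u (insert (v, s) C)) :=
  ⟨fun C hC D hD hCD => insert_injOn hv hC hD (h.1 (hEF C hC) (hEF D hD) hCD),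
    fun C hC hm => h.2 _ (hEF C hC) (hE hm)⟩

lemma isDopedTree_doping_smu : ∀ (T : LTree) (u : Finset Lit → ℕ), T.labels.Nodup →
    IsDopingMap T.smu u → IsDopedTree T.shape (doping u T.smu)
  | .leaf, u, _, _ => by
    have : doping u LTree.leaf.smu = {{(u ∅, true)}} := by
      simp [doping, LTree.smu]
    rw [this]
    exact IsDopedTree.leaf _
  | .node v l r, u, hn, hu => by
    rw [LTree.labels, List.nodup_cons, List.mem_append, not_or, List.nodup_append'] at hn
    obtain ⟨⟨hvl, hvr⟩, hl, hr, hlr⟩ := hn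
    have hvl' : v ∉ vars l.smu := fun h => hvl (List.mem_toFinset.1 (l.vars_smu_subset h))
    have hvr' : v ∉ vars r.smu := fun h => hvr (List.mem_toFinset.1 (r.vars_smu_subset h))
    have hlr' : Disjoint (vars l.smu) (vars r.smu) := by
      rw [Finset.disjoint_left]
      intro w hw hw'
      exact hlr (List.mem_toFinset.1 (l.vars_smu_subset hw))
        (List.mem_toFinset.1 (r.vars_smu_subset hw'))
    rw [LTree.smu_node] at hu ⊢
    have hvars := vars_branch v (E' := r.smu) l.smu_nonempty
    have hml : ∀ C ∈ l.smu, insert (v, true) C ∈ branch v l.smu r.smu := fun C hC =>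
      mem_branch.2 (Or.inl ⟨C, hC, rfl⟩)
    have hmr : ∀ C ∈ r.smu, insert (v, false) C ∈ branch v l.smu r.smu := fun C hC =>
      mem_branch.2 (Or.inr ⟨C, hC, rfl⟩)
    have hsl : vars l.smu ⊆ vars (branch v l.smu r.smu) := by
      rw [hvars]
      exact Finset.subset_union_left.trans (Finset.subset_insert _ _)
    have hsr : vars r.smu ⊆ vars (branch v l.smu r.smu) := by
      rw [hvars]
      exact Finset.subset_union_right.trans (Finset.subset_insert _ _)
    have hvm : v ∈ vars (branch v l.smu r.smu) := by
      rw [hvars]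
      exact Finset.mem_insert_self _ _
    rw [doping_branch]
    refine IsDopedTree.node v
      (isDopedTree_doping_smu l _ hl (isDopingMap_insert hu hml hsl hvl'))
      (isDopedTree_doping_smu r _ hr (isDopingMap_insert hu hmr hsr hvr')) ?_ ?_ ?_
    · intro h
      rcases Finset.mem_union.1 (vars_doping_subset _ _ h) with h | h
      · exact hvl' h
      · obtain ⟨C, hC, h⟩ := Finset.mem_image.1 h
        exact hu.2 _ (hml C hC) (by rw [h]; exact hvm)
    · intro h
      rcases Finset.mem_union.1 (vars_doping_subset _ _ h) with h | h
      · exact hvr' h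
      · obtain ⟨C, hC, h⟩ := Finset.mem_image.1 h
        exact hu.2 _ (hmr C hC) (by rw [h]; exact hvm)
    · rw [Finset.disjoint_left]
      intro w hw hw'
      rcases Finset.mem_union.1 (vars_doping_subset _ _ hw) with h | h <;>
        rcases Finset.mem_union.1 (vars_doping_subset _ _ hw') with h' | h'
      · exact Finset.disjoint_left.1 hlr' h h'
      · obtain ⟨C, hC, rfl⟩ := Finset.mem_image.1 h'
        exact hu.2 _ (hmr C hC) (hsl h)
      · obtain ⟨C, hC, rfl⟩ := Finset.mem_image.1 h
        exact hu.2 _ (hml C hC) (hsr h')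
      -- Equal doping variables would mean equal clauses, but the two clauses contain opposite
      -- literals of `v`.
      · obtain ⟨C, hC, rfl⟩ := Finset.mem_image.1 h
        obtain ⟨D, hD, h⟩ := Finset.mem_image.1 h'
        have := hu.1 (hmr D hD) (hml C hC) h
        have hm : (v, true) ∈ insert (v, false) D := by
          rw [this]
          exact Finset.mem_insert_self _ _
        rcases Finset.mem_insert.1 hm with h | h
        · simp at h
        · exact hvr' (clauseVars_subset_vars hD (mem_clauseVars_of_mem h))

/-! ### Asymptotics -/

section Asymptotics

open Asymptotics Filter

lemma isTheta_pow_of_le_of_le {f : ℕ → ℝ} {k : ℕ} {c d : ℝ} (hc : 0 < c)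
    (h1 : ∀ᶠ h : ℕ in atTop, c * (h : ℝ) ^ k ≤ f h)
    (h2 : ∀ᶠ h : ℕ in atTop, f h ≤ d * (h : ℝ) ^ k) :
    f =Θ[atTop] (fun h : ℕ => (h : ℝ) ^ k) := by
  constructor
  · refine IsBigO.of_bound d ?_
    filter_upwards [h1, h2] with h h1 h2
    have : (0 : ℝ) ≤ (h : ℝ) ^ k := by positivity
    rw [Real.norm_of_nonneg this, Real.norm_of_nonneg (le_trans (by positivity) h1)]
    exact h2
  · refine IsBigO.of_bound c⁻¹ ?_
    filter_upwards [h1] with h h1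
    have : (0 : ℝ) ≤ (h : ℝ) ^ k := by positivity
    rw [Real.norm_of_nonneg this, Real.norm_of_nonneg (le_trans (by positivity) h1),
      le_inv_mul_iff₀ hc]
    exact h1

lemma numLeaves_extremalTree_bounds (k : ℕ) : ∃ c > (0 : ℝ), ∃ d : ℝ, ∀ᶠ h : ℕ in atTop,
    c * (h : ℝ) ^ k ≤ ((extremalTree k h).numLeaves : ℝ) ∧
      ((extremalTree k h).numLeaves : ℝ) ≤ d * (h : ℝ) ^ k := by
  -- The lower constant comes from `(h + 1 - k) ^ k / k!` as a lower bound of the binomial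
  -- coefficient and `h + 1 - k ≥ h / 2`; the upper one from `h + 1 ≤ 2 * h`.
  refine ⟨(2 ^ k * (k.factorial : ℝ))⁻¹, by positivity, 2 ^ k, ?_⟩
  filter_upwards [eventually_ge_atTop (2 * k + 1)] with h hh
  constructor
  · have h1 := Nat.pow_le_choose (α := ℝ) k h
    have h2 : ((h.choose k : ℕ) : ℝ) ≤ ((extremalTree k h).numLeaves : ℝ) := by
      exact_mod_cast choose_le_numLeaves_extremalTree k h
    refine le_trans ?_ (h1.trans h2)
    have h3 : (h : ℝ) / 2 ≤ ((h + 1 - k : ℕ) : ℝ) := by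
      rw [Nat.cast_sub (by omega)]
      push_cast
      have : (2 * k + 1 : ℝ) ≤ h := by exact_mod_cast hh
      linarith
    have h4 : ((h : ℝ) / 2) ^ k ≤ ((h + 1 - k : ℕ) : ℝ) ^ k :=
      pow_le_pow_left₀ (by positivity) h3 k
    rw [div_pow] at h4
    rw [mul_inv, mul_right_comm, inv_mul_eq_div, ← div_eq_mul_inv]
    exact div_le_div_of_nonneg_right h4 (by positivity)
  · have h1 : ((extremalTree k h).numLeaves : ℝ) ≤ ((h + 1 : ℕ) : ℝ) ^ k := by
      exact_mod_cast numLeaves_extremalTree_le k h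
    refine h1.trans ?_
    rw [← mul_pow]
    refine pow_le_pow_left₀ (by positivity) ?_ k
    have : (1 : ℝ) ≤ h := by exact_mod_cast (by omega : 1 ≤ h)
    push_cast
    linarith

end Asymptotics

/-! ### Chains of implications -/

/-- The variable with level `i` and role `s`; its binary expansion is that of `2 * s + 1`, shifted
by `i` digits. -/
def levelVar (i s : ℕ) : ℕ := 2 ^ i * (2 * s + 1)

/-- The level is the exponent of two in the number, and the role determines its odd part. -/
lemma levelVar_inj {i s i' s' : ℕ} : levelVar i s = levelVar i' s' ↔ i = i' ∧ s = s' := by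
  have key : ∀ i s j s', levelVar i s = levelVar (i + j) s' → j = 0 ∧ s = s' := by
    intro i s j s' h
    unfold levelVar at h
    rw [pow_add, mul_assoc] at h
    have h := Nat.eq_of_mul_eq_mul_left (by positivity) h
    cases j with
    | zero => exact ⟨rfl, by omega⟩
    | succ j =>
      rw [pow_succ, mul_comm (2 ^ j), mul_assoc] at h
      omega
  constructor
  · intro h
    rcases le_total i i' with hi | hi
    · obtain ⟨j, rfl⟩ := Nat.exists_eq_add_of_le hi
      obtain ⟨rfl, rfl⟩ := key _ _ _ _ h
      exact ⟨rfl, rfl⟩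
    · obtain ⟨j, rfl⟩ := Nat.exists_eq_add_of_le hi
      obtain ⟨rfl, rfl⟩ := key _ _ _ _ h.symm
      exact ⟨rfl, rfl⟩
  · rintro ⟨rfl, rfl⟩
    rfl

lemma exists_assignment (f : ℕ → ℕ → Bool) : ∃ a : ℕ → Bool, ∀ i s, a (levelVar i s) = f i s := by
  have hinj : Function.Injective (fun p : ℕ × ℕ => levelVar p.1 p.2) := by
    rintro ⟨i, s⟩ ⟨i', s'⟩ h
    obtain ⟨rfl, rfl⟩ := levelVar_inj.1 h
    rfl
  refine ⟨fun v => f (Function.invFun (fun p : ℕ × ℕ => levelVar p.1 p.2) v).1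
    (Function.invFun (fun p : ℕ × ℕ => levelVar p.1 p.2) v).2, fun i s => ?_⟩
  have := Function.leftInverse_invFun hinj (i, s)
  simp only at this
  simp only [this]

/-- The clause stating that the variable of role `o` at level `a` implies the one at level `a + 1`,
or else the variable of role `o + r` at level `a + 1`. -/
def chainClause (o a r : ℕ) : Finset Lit :=
  {(levelVar a o, false), (levelVar (a + 1) o, true), (levelVar (a + 1) (o + r), true)}

/-- A chain of `m` implications, each of them in two versions with different exceptions. -/
def chain (o m : ℕ) : Finset (Finset Lit) :=
  (Finset.range m).biUnion fun a => {chainClause o a 1, chainClause o a 2}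

lemma mem_chain {o m : ℕ} {C : Finset Lit} :
    C ∈ chain o m ↔ ∃ a < m, ∃ r, (r = 1 ∨ r = 2) ∧ C = chainClause o a r := by
  simp only [chain, Finset.mem_biUnion, Finset.mem_range, Finset.mem_insert, Finset.mem_singleton]
  constructor
  · rintro ⟨a, ha, h | h⟩
    · exact ⟨a, ha, 1, Or.inl rfl, h⟩
    · exact ⟨a, ha, 2, Or.inr rfl, h⟩
  · rintro ⟨a, ha, r, rfl | rfl, h⟩
    · exact ⟨a, ha, Or.inl h⟩
    · exact ⟨a, ha, Or.inr h⟩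

lemma clauseVars_chainClause (o a r : ℕ) : clauseVars (chainClause o a r) =
    {levelVar a o, levelVar (a + 1) o, levelVar (a + 1) (o + r)} := by
  simp [chainClause, clauseVars, Finset.image_insert]

lemma exists_of_mem_vars_chain {o m v : ℕ} (h : v ∈ vars (chain o m)) :
    ∃ i s, v = levelVar i s ∧ i ≤ m ∧ 0 < m ∧ o ≤ s ∧ s < o + 3 := by
  obtain ⟨C, hC, hv⟩ := mem_vars.1 h
  obtain ⟨a, ha, r, hr, rfl⟩ := mem_chain.1 hC
  rw [clauseVars_chainClause, Finset.mem_insert, Finset.mem_insert, Finset.mem_singleton] at hv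
  rcases hv with rfl | rfl | rfl
  · exact ⟨a, o, rfl, by omega, by omega, by omega, by omega⟩
  · exact ⟨a + 1, o, rfl, by omega, by omega, by omega, by omega⟩
  · exact ⟨a + 1, o + r, rfl, by omega, by omega, by omega, by omega⟩

lemma chain_mem_CLS (o m : ℕ) : chain o m ∈ CLS := by
  intro C hC
  obtain ⟨a, -, r, hr, rfl⟩ := mem_chain.1 hC
  rw [isClause_iff]
  intro x hx hx'
  simp only [chainClause, Finset.mem_insert, Finset.mem_singleton] at hx hx'
  rcases hx with rfl | rfl | rfl <;> simp [Lit.compl, levelVar_inj] at hx'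

lemma models_chain {o m : ℕ} {a : ℕ → Bool} : Models a (chain o m) ↔
    ∀ i < m, ∀ r, (r = 1 ∨ r = 2) → (a (levelVar i o) = false ∨ a (levelVar (i + 1) o) = true ∨
      a (levelVar (i + 1) (o + r)) = true) := by
  have : ∀ i r, Sat a (chainClause o i r) ↔ (a (levelVar i o) = false ∨
      a (levelVar (i + 1) o) = true ∨ a (levelVar (i + 1) (o + r)) = true) := by
    intro i r
    simp [Sat, chainClause]
  constructor
  · intro h i hi r hr
    exact (this i r).1 (h _ (mem_chain.2 ⟨i, hi, r, hr, rfl⟩))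
  · intro h C hC
    obtain ⟨i, hi, r, hr, rfl⟩ := mem_chain.1 hC
    exact (this i r).2 (h i hi r hr)

/-- The implicate of `chain o m` obtained from the choice of exceptions given by `V`. -/
def chainImplicate (o m : ℕ) (V : Finset ℕ) : Finset Lit :=
  {(levelVar 0 o, false), (levelVar m o, true)} ∪
    (Finset.range m).image fun a => (levelVar (a + 1) (o + if a ∈ V then 1 else 2), true)

lemma mem_chainImplicate {o m : ℕ} {V : Finset ℕ} {x : Lit} : x ∈ chainImplicate o m V ↔
    x = (levelVar 0 o, false) ∨ x = (levelVar m o, true) ∨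
      ∃ a < m, x = (levelVar (a + 1) (o + if a ∈ V then 1 else 2), true) := by
  simp only [chainImplicate, Finset.mem_union, Finset.mem_insert, Finset.mem_singleton,
    Finset.mem_image, Finset.mem_range, or_assoc]
  simp only [eq_comm]

/-- If all chosen exceptions fail, truth propagates from level `0` to level `m`. For minimality,
every literal of the implicate is the only one satisfied by some model of the chain. -/
lemma isMinImplicate_chainImplicate {o m : ℕ} (hm : 1 ≤ m) (V : Finset ℕ) :
    IsMinImplicate (chain o m) (chainImplicate o m V) := by
  refine ⟨?_, ?_, ?_, fun D hD hED => Finset.Subset.antisymm hD fun x hx => ?_⟩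
  · rw [isClause_iff]
    intro x hx hx'
    rw [mem_chainImplicate] at hx hx'
    rcases hx with rfl | rfl | ⟨a, -, rfl⟩ <;> simp [Lit.compl, levelVar_inj] at hx' <;> omega
  · intro v hv
    obtain ⟨b, hb⟩ := mem_clauseVars.1 hv
    rw [mem_chainImplicate] at hb
    rw [mem_vars]
    simp only [Prod.mk.injEq] at hb
    rcases hb with ⟨rfl, -⟩ | ⟨rfl, -⟩ | ⟨a, ha, rfl, -⟩
    · exact ⟨_, mem_chain.2 ⟨0, by omega, 1, Or.inl rfl, rfl⟩, by simp [clauseVars_chainClause]⟩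
    · exact ⟨_, mem_chain.2 ⟨m - 1, by omega, 1, Or.inl rfl, rfl⟩, by
        rw [clauseVars_chainClause, Nat.sub_add_cancel hm]
        simp⟩
    · refine ⟨_, mem_chain.2 ⟨a, ha, if a ∈ V then 1 else 2, by split_ifs <;> simp, rfl⟩, ?_⟩
      simp [clauseVars_chainClause]
  · intro a ha
    rw [models_chain] at ha
    by_contra hs
    have h0 : a (levelVar 0 o) = true := by
      by_contra h
      exact hs ⟨_, mem_chainImplicate.2 (Or.inl rfl), by simpa using h⟩
    have hstep : ∀ i ≤ m, a (levelVar i o) = true := by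
      intro i
      induction i with
      | zero => exact fun _ => h0
      | succ i ih =>
        intro hi
        rcases ha i (by omega) (if i ∈ V then 1 else 2) (by split_ifs <;> simp) with h | h | h
        · rw [ih (by omega)] at h
          simp at h
        · exact h
        · exact absurd ⟨_, mem_chainImplicate.2 (Or.inr (Or.inr ⟨i, by omega, rfl⟩)), h⟩ hs
    exact hs ⟨_, mem_chainImplicate.2 (Or.inr (Or.inl rfl)), hstep m le_rfl⟩
  -- In the `i`-th model truth is propagated up to just below level `i`, and all exceptions of level
  -- `i`, and only those, hold.
  · have key : ∀ i, ∃ a : ℕ → Bool, Models a (chain o m) ∧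
        (∀ l, a (levelVar l o) = decide (l < i)) ∧
        ∀ l r, 1 ≤ r → a (levelVar l (o + r)) = decide (l = i) := by
      intro i
      obtain ⟨a, ha⟩ := exists_assignment
        (fun l s => if s = o then decide (l < i) else decide (l = i))
      have h1 : ∀ l, a (levelVar l o) = decide (l < i) := fun l => by simp [ha]
      have h2 : ∀ l r, 1 ≤ r → a (levelVar l (o + r)) = decide (l = i) := fun l r hr => by
        rw [ha, if_neg (by omega)]
      refine ⟨a, models_chain.2 fun l _ r hr => ?_, h1, h2⟩
      rw [h1, h1, h2 _ _ (by omega)]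
      simp only [decide_eq_false_iff_not, decide_eq_true_eq]
      omega
    have hr : ∀ a, 1 ≤ if a ∈ V then 1 else 2 := fun a => by split_ifs <;> omega
    rw [mem_chainImplicate] at hx
    -- The break is placed at `0` for the initial literal, past the end at `m + 1` for the final
    -- one, and at level `b + 1` for an exception of that level.
    obtain ⟨i, hi⟩ : ∃ i, ∀ a : ℕ → Bool, (∀ l, a (levelVar l o) = decide (l < i)) →
        (∀ l r, 1 ≤ r → a (levelVar l (o + r)) = decide (l = i)) →
        ∀ z ∈ chainImplicate o m V, a z.1 = z.2 → z = x := by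
      rcases hx with rfl | rfl | ⟨b, hb, rfl⟩
      · refine ⟨0, fun a h1 h2 z hz haz => ?_⟩
        rcases mem_chainImplicate.1 hz with rfl | rfl | ⟨c, hc, rfl⟩
        · rfl
        · simp [h1] at haz
        · simp [h2 _ _ (hr c)] at haz
      · refine ⟨m + 1, fun a h1 h2 z hz haz => ?_⟩
        rcases mem_chainImplicate.1 hz with rfl | rfl | ⟨c, hc, rfl⟩
        · simp [h1] at haz
        · rfl
        · simp [h2 _ _ (hr c)] at haz
          omega
      · refine ⟨b + 1, fun a h1 h2 z hz haz => ?_⟩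
        rcases mem_chainImplicate.1 hz with rfl | rfl | ⟨c, hc, rfl⟩
        · simp [h1] at haz
        · simp [h1] at haz
          omega
        · simp [h2 _ _ (hr c)] at haz
          rw [haz]
    obtain ⟨a, ha, h1, h2⟩ := key i
    obtain ⟨z, hz, haz⟩ := hED a ha
    rw [← hi a h1 h2 z (hD hz) haz]
    exact hz

/-- The `2 ^ m` choices of exceptions give distinct implicates, because `V` can be read off from the
exceptions of role `o + 1`. -/
lemma hasSparseTriggers_chain {o m : ℕ} (hm : 1 ≤ m) : HasSparseTriggers 0 (2 ^ m) (chain o m) := by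
  refine hasSparseTriggers_zero (A := (Finset.range m).powerset.image (chainImplicate o m))
    (le_of_eq ?_) fun C hC => ?_
  · rw [Finset.card_image_of_injOn, Finset.card_powerset, Finset.card_range]
    have key : ∀ V a, a < m →
        ((levelVar (a + 1) (o + 1), true) ∈ chainImplicate o m V ↔ a ∈ V) := by
      intro V a ha
      rw [mem_chainImplicate]
      simp only [Prod.mk.injEq, levelVar_inj]
      constructor
      · rintro (h | h | ⟨b, hb, ⟨h1, h2⟩, -⟩)
        · omega
        · omega
        · have : b = a := by omega
          subst this
          by_contra hV
          rw [if_neg hV] at h2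
          omega
      · intro h
        exact Or.inr (Or.inr ⟨a, ha, by simp [h]⟩)
    intro V hV W hW h
    rw [Finset.mem_coe, Finset.mem_powerset] at hV hW
    ext a
    constructor
    · intro ha
      have ha' := Finset.mem_range.1 (hV ha)
      rw [← key W a ha', ← h, key V a ha']
      exact ha
    · intro ha
      have ha' := Finset.mem_range.1 (hW ha)
      rw [← key V a ha', h, key W a ha']
      exact ha
  · obtain ⟨V, -, rfl⟩ := Finset.mem_image.1 hC
    exact isMinImplicate_chainImplicate hm V

/-! ### Refuting chains by unit propagation -/

lemma derives_res_unit {G : Finset (Finset Lit)} {v : ℕ} {R : Finset Lit} {T : ResTree}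
    (hT : Derives G T {(v, true)}) (hR : insert (v, false) R ∈ G) (hvR : v ∉ clauseVars R) :
    Derives G (.res (v, true) T (.ax (insert (v, false) R))) R := by
  have hn : ∀ s, (v, s) ∉ R := fun s h => hvR (mem_clauseVars_of_mem h)
  refine ⟨⟨hT.1, hR, ?_⟩, ?_⟩
  · rw [hT.2, ResTree.concl]
    ext z
    rw [Finset.mem_inter, mem_complSet, Finset.mem_singleton]
    constructor
    · exact fun h => h.1
    · rintro rfl
      exact ⟨rfl, Finset.mem_insert_self _ _⟩
  · rw [ResTree.concl, hT.2, ResTree.concl]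
    ext z
    simp only [Finset.mem_sdiff, Finset.mem_union, Finset.mem_singleton, Finset.mem_insert,
      Lit.compl]
    constructor
    · rintro ⟨h | h | h, h'⟩
      · simp [h] at h'
      · simp [h] at h'
      · exact h
    · intro h
      refine ⟨Or.inr (Or.inr h), ?_⟩
      rintro (rfl | rfl)
      · exact hn _ h
      · exact hn _ h

/-- If no refutation of Horton-Strahler number at most `1` exists, the positive units derivable
within that number define a model. Resolving a tree with an axiom keeps the number at most `1`. -/
lemma refutableBy_chain (o m : ℕ) : RefutableBy 1 (chain o m) := by
  classical
  intro φ hφ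
  by_contra hno
  let Unit' : ℕ → Prop := fun l =>
    ∃ T, Derives (φ.apply (chain o m)) T {(levelVar l o, true)} ∧ T.shape.hts ≤ 1
  -- Unassigned exceptions are made true, so a violated clause has its exception falsified by `φ`,
  -- and what remains is one propagation step.
  obtain ⟨b, hb⟩ := exists_assignment (fun l s => if s = o then decide (Unit' l) else true)
  have hb1 : ∀ l, b (levelVar l o) = decide (Unit' l) := fun l => by simp [hb]
  have hb2 : ∀ l r, 1 ≤ r → b (levelVar l (o + r)) = true := fun l r hr => by
    rw [hb, if_neg (by omega)]
  rw [unsatisfiable_apply_iff] at hφ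
  refine hφ (fun v => (φ.val v).getD (b v)) (fun v c hv => by simp [hv]) ?_
  rw [models_chain]
  intro i hi r hr
  by_contra hs
  push Not at hs
  obtain ⟨h1, h2, h3⟩ := hs
  have hC : chainClause o i r ∈ chain o m := mem_chain.2 ⟨i, hi, r, hr, rfl⟩
  have h3 : φ.val (levelVar (i + 1) (o + r)) = some false := by
    rcases h : φ.val (levelVar (i + 1) (o + r)) with _ | c
    · simp [h, hb2 _ r (by omega)] at h3
    · cases c
      · rfl
      · simp [h] at h3
  have hjoin : ∀ T : ResTree, T.shape.hts ≤ 1 → ∀ x C, (ResTree.res x T (.ax C)).shape.hts ≤ 1 :=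
    fun T hT x C => (joinHts_mono hT le_rfl : joinHts _ 0 ≤ joinHts 1 0)
  rcases hv1 : φ.val (levelVar i o) with _ | c1 <;>
    rcases hv2 : φ.val (levelVar (i + 1) o) with _ | c2
  · have hD : insert (levelVar i o, false) {(levelVar (i + 1) o, true)} ∈ φ.apply (chain o m) := by
      refine PartialAssignment.mem_apply.2 ⟨_, hC, ?_, ?_⟩ <;>
        simp [chainClause, PartialAssignment.lit, hv1, hv2, h3, Finset.filter_insert,
          Finset.filter_singleton]
    obtain ⟨T, hT, hT1⟩ : Unit' i := by simpa [hv1, hb1] using h1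
    have hU : ¬ Unit' (i + 1) := by simpa [hv2, hb1] using h2
    exact hU ⟨_, derives_res_unit hT hD (by simp [clauseVars, levelVar_inj]), hjoin T hT1 _ _⟩
  · have : c2 = false := by
      cases c2
      · rfl
      · simp [hv2] at h2
    subst this
    have hD : insert (levelVar i o, false) ∅ ∈ φ.apply (chain o m) := by
      refine PartialAssignment.mem_apply.2 ⟨_, hC, ?_, ?_⟩ <;>
        simp [chainClause, PartialAssignment.lit, hv1, hv2, h3, Finset.filter_insert,
          Finset.filter_singleton]
    obtain ⟨T, hT, hT1⟩ : Unit' i := by simpa [hv1, hb1] using h1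
    exact hno ⟨_, derives_res_unit hT hD (by simp [clauseVars]), hjoin T hT1 _ _⟩
  · have : c1 = true := by
      cases c1
      · simp [hv1] at h1
      · rfl
    subst this
    have hD : {(levelVar (i + 1) o, true)} ∈ φ.apply (chain o m) := by
      refine PartialAssignment.mem_apply.2 ⟨_, hC, ?_, ?_⟩ <;>
        simp [chainClause, PartialAssignment.lit, hv1, hv2, h3, Finset.filter_insert,
          Finset.filter_singleton]
    have hU : ¬ Unit' (i + 1) := by simpa [hv2, hb1] using h2
    exact hU ⟨.ax _, ⟨hD, rfl⟩, by simp [ResTree.shape, FullTree.hts]⟩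
  · have : c1 = true := by
      cases c1
      · simp [hv1] at h1
      · rfl
    subst this
    have : c2 = false := by
      cases c2
      · rfl
      · simp [hv2] at h2
    subst this
    have hD : ∅ ∈ φ.apply (chain o m) := by
      refine PartialAssignment.mem_apply.2 ⟨_, hC, ?_, ?_⟩ <;>
        simp [chainClause, PartialAssignment.lit, hv1, hv2, h3, Finset.filter_insert,
          Finset.filter_singleton]
    exact hno ⟨.ax _, ⟨hD, rfl⟩, by simp [ResTree.shape, FullTree.hts]⟩

/-! ### Complete trees of chains -/

/-- The number of roles in a complete tree of depth `d` with chains at its leaves. -/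
def numRoles : ℕ → ℕ
  | 0 => 3
  | d + 1 => 1 + 2 * numRoles d

/-- The complete branching tree of depth `d` with chains of length `m` at its leaves; its roles
start with `o`. -/
def chainTree : ℕ → ℕ → ℕ → Finset (Finset Lit)
  | 0, o, m => chain o m
  | d + 1, o, m => branch (levelVar 0 o) (chainTree d (o + 1) m)
      (chainTree d (o + 1 + numRoles d) m)

lemma numRoles_pos : ∀ d, 3 ≤ numRoles d
  | 0 => le_rfl
  | d + 1 => by
    have := numRoles_pos d
    rw [numRoles]
    omega

lemma chainTree_zero_right : ∀ d o, chainTree d o 0 = ∅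
  | 0, o => by simp [chainTree, chain]
  | d + 1, o => by
    rw [chainTree, chainTree_zero_right d, chainTree_zero_right d]
    rfl

lemma exists_of_mem_vars_chainTree {d o m v : ℕ} (h : v ∈ vars (chainTree d o m)) :
    ∃ i s, v = levelVar i s ∧ i ≤ m ∧ 0 < m ∧ o ≤ s ∧ s < o + numRoles d := by
  induction d generalizing o with
  | zero => exact exists_of_mem_vars_chain h
  | succ d ih =>
    rcases Nat.eq_zero_or_pos m with rfl | hm
    · rw [chainTree_zero_right] at h
      simp [vars] at h
    rw [chainTree] at h
    have h := vars_branch_subset _ _ _ h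
    rw [Finset.mem_insert, Finset.mem_union] at h
    rw [numRoles]
    rcases h with rfl | h | h
    · exact ⟨0, o, rfl, by omega, hm, by omega, by omega⟩
    · obtain ⟨i, s, rfl, h⟩ := ih h
      exact ⟨i, s, rfl, by omega⟩
    · obtain ⟨i, s, rfl, h⟩ := ih h
      exact ⟨i, s, rfl, by omega⟩

lemma levelVar_notMem_vars_chainTree {d o m i s : ℕ} (h : s < o ∨ o + numRoles d ≤ s) :
    levelVar i s ∉ vars (chainTree d o m) := by
  intro hm
  obtain ⟨i', s', h1, h2⟩ := exists_of_mem_vars_chainTree hm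
  rw [levelVar_inj] at h1
  omega

lemma chainTree_mem_CLS : ∀ d o m, chainTree d o m ∈ CLS
  | 0, _, _ => chain_mem_CLS _ _
  | _ + 1, _, _ => branch_mem_CLS (chainTree_mem_CLS _ _ _) (chainTree_mem_CLS _ _ _)
      (levelVar_notMem_vars_chainTree (by omega)) (levelVar_notMem_vars_chainTree (by omega))

lemma models_true_chainTree : ∀ d o m, Models (fun _ => true) (chainTree d o m)
  | 0, _, _ => models_chain.2 fun _ _ _ _ => Or.inr (Or.inl rfl)
  | _ + 1, _, _ => models_branch.2 ⟨fun _ => models_true_chainTree _ _ _,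
      fun _ => models_true_chainTree _ _ _⟩

lemma chainTree_nonempty {m : ℕ} (hm : 1 ≤ m) : ∀ d o, (chainTree d o m).Nonempty
  | 0, _ => ⟨_, mem_chain.2 ⟨0, hm, 1, Or.inl rfl, rfl⟩⟩
  | d + 1, _ => branch_nonempty _ (chainTree_nonempty hm d _)

/-- Chains have hardness bound `1`, and each level of the complete tree joins two equal numbers,
adding one. -/
lemma refutableBy_chainTree : ∀ d o m, RefutableBy (d + 1) (chainTree d o m)
  | 0, o, m => refutableBy_chain o m
  | d + 1, o, m => by
    have := (refutableBy_chainTree d (o + 1) m).branch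
      (refutableBy_chainTree d (o + 1 + numRoles d) m)
      (v := levelVar 0 o)
      (levelVar_notMem_vars_chainTree (by omega)) (levelVar_notMem_vars_chainTree (by omega))
    rw [chainTree]
    refine this.mono ?_
    rw [joinHts, if_pos rfl]
    omega

lemma hasSparseTriggers_chainTree {m : ℕ} (hm : 1 ≤ m) :
    ∀ d o, HasSparseTriggers d (2 ^ m) (chainTree d o m)
  | 0, o => hasSparseTriggers_chain hm
  | d + 1, o => by
    refine hasSparseTriggers_branch (hasSparseTriggers_chainTree hm d _)
      (hasSparseTriggers_chainTree hm d _) (chainTree_nonempty hm d _)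
      (levelVar_notMem_vars_chainTree (by omega)) (levelVar_notMem_vars_chainTree (by omega)) ?_
    rw [Finset.disjoint_left]
    intro v h h'
    obtain ⟨i, s, rfl, h⟩ := exists_of_mem_vars_chainTree h
    exact levelVar_notMem_vars_chainTree (by omega) h'

/-! ### The separating sequence -/

/-- The `j`-th variable, when there are `c` roles. -/
def seqVar (c j : ℕ) : ℕ := levelVar (j / c) (j % c)

/-- The clause-set with `n` variables separating `UC (k + 1)` from `WC k`: a tree of chains as long
as possible, a unit clause, and clauses subsumed by this unit clause. -/
def separatingSeq (k n : ℕ) : Finset (Finset Lit) :=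
  ((Finset.range n).image fun j => {(levelVar 0 0, true), (seqVar (1 + numRoles k) j, true)}) ∪
    chainTree k 1 (n / (1 + numRoles k) - 1)

lemma mem_separatingSeq {k n : ℕ} {C : Finset Lit} : C ∈ separatingSeq k n ↔
    (∃ j < n, C = {(levelVar 0 0, true), (seqVar (1 + numRoles k) j, true)}) ∨
      C ∈ chainTree k 1 (n / (1 + numRoles k) - 1) := by
  simp only [separatingSeq, Finset.mem_union, Finset.mem_image, Finset.mem_range, eq_comm]

lemma seqVar_injective (c : ℕ) : Function.Injective (seqVar c) := by
  intro i j h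
  obtain ⟨h1, h2⟩ := levelVar_inj.1 h
  rw [← Nat.div_add_mod i c, ← Nat.div_add_mod j c, h1, h2]

lemma seqVar_zero (c : ℕ) : seqVar c 0 = levelVar 0 0 := by
  simp [seqVar]

/-- The padding clauses mention the first `n` variables in level order. The chains use levels up to
`n / c - 1`, with `c = 1 + numRoles k` roles per level, so they stay among these. -/
lemma vars_separatingSeq {k n : ℕ} (hn : 1 ≤ n) :
    vars (separatingSeq k n) = (Finset.range n).image (seqVar (1 + numRoles k)) := by
  ext v
  rw [Finset.mem_image, mem_vars]
  constructor
  · rintro ⟨C, hC, hv⟩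
    rcases mem_separatingSeq.1 hC with ⟨j, hj, rfl⟩ | hC
    · simp only [clauseVars, Finset.image_insert, Finset.image_singleton, Finset.mem_insert,
        Finset.mem_singleton] at hv
      rcases hv with rfl | rfl
      · exact ⟨0, Finset.mem_range.2 hn, seqVar_zero _⟩
      · exact ⟨j, Finset.mem_range.2 hj, rfl⟩
    · obtain ⟨i, s, rfl, h1, h2, h3, h4⟩ :=
        exists_of_mem_vars_chainTree (clauseVars_subset_vars hC hv)
      refine ⟨(1 + numRoles k) * i + s, Finset.mem_range.2 ?_, ?_⟩
      · calc (1 + numRoles k) * i + s < (1 + numRoles k) * (i + 1) := by rw [mul_add]; omega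
          _ ≤ (1 + numRoles k) * (n / (1 + numRoles k)) := Nat.mul_le_mul_left _ (by omega)
          _ ≤ n := Nat.mul_div_le _ _
      · rw [seqVar, Nat.mul_add_div (by omega), Nat.div_eq_of_lt h4, Nat.mul_add_mod,
          Nat.mod_eq_of_lt h4, add_zero]
  · rintro ⟨j, hj, rfl⟩
    exact ⟨_, mem_separatingSeq.2 (Or.inl ⟨j, Finset.mem_range.1 hj, rfl⟩), by simp [clauseVars]⟩

lemma numVars_separatingSeq {k n : ℕ} (hn : 1 ≤ n) : numVars (separatingSeq k n) = n := by
  rw [numVars, vars_separatingSeq hn, Finset.card_image_of_injective _ (seqVar_injective _),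
    Finset.card_range]

lemma separatingSeq_mem_CLS (k n : ℕ) : separatingSeq k n ∈ CLS := by
  intro C hC
  rcases mem_separatingSeq.1 hC with ⟨j, -, rfl⟩ | hC
  · rw [isClause_iff]
    intro x hx hx'
    simp only [Finset.mem_insert, Finset.mem_singleton] at hx hx'
    rcases hx with rfl | rfl <;> simp [Lit.compl] at hx'
  · exact chainTree_mem_CLS _ _ _ C hC

lemma models_true_separatingSeq (k n : ℕ) : Models (fun _ => true) (separatingSeq k n) := by
  intro C hC
  rcases mem_separatingSeq.1 hC with ⟨j, -, rfl⟩ | hC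
  · exact ⟨_, Finset.mem_insert_self _ _, rfl⟩
  · exact models_true_chainTree _ _ _ C hC

lemma models_separatingSeq {k n : ℕ} {b : ℕ → Bool} (hb : b (levelVar 0 0) = true) :
    Models b (separatingSeq k n) ↔ Models b (chainTree k 1 (n / (1 + numRoles k) - 1)) := by
  constructor
  · exact fun h C hC => h C (mem_separatingSeq.2 (Or.inr hC))
  · intro h C hC
    rcases mem_separatingSeq.1 hC with ⟨j, -, rfl⟩ | hC
    · exact ⟨_, Finset.mem_insert_self _ _, hb⟩
    · exact h C hC

/-- The case `j = 0` of the padding is the unit clause of `levelVar 0 0`. If this is not falsified,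
it may be set to true, which satisfies all the padding. -/
lemma separatingSeq_mem_UC {k n : ℕ} (hn : 1 ≤ n) : separatingSeq k n ∈ UC (k + 1) := by
  refine RefutableBy.mem_UC ?_ (separatingSeq_mem_CLS k n) ⟨_, models_true_separatingSeq k n⟩
  refine refutableBy_of_not_false (x := (levelVar 0 0, true))
    (mem_separatingSeq.2 (Or.inl ⟨0, hn, by simp [seqVar_zero]⟩)) fun φ hφ hun => ?_
  obtain ⟨T, hT, hk⟩ := (refutableBy_chainTree k 1 (n / (1 + numRoles k) - 1)).transfer hun
    (levelVar 0 0) true (levelVar_notMem_vars_chainTree (by omega))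
    (fun h => hφ (PartialAssignment.lit_eq_some.2 h)) fun b hb => (models_separatingSeq hb).2
  exact ⟨T, hT.mono (φ.apply_mono Finset.subset_union_right), hk⟩

/-- Here the forced variable `levelVar 0 0` plays the role of `v` in `HasSparseTriggers.le_card`. -/
lemma two_pow_le_card_of_equivalent {k n : ℕ} (hn : 2 ≤ n / (1 + numRoles k))
    {F' : Finset (Finset Lit)} (heq : Equivalent F' (separatingSeq k n)) (hW : F' ∈ WC k) :
    2 ^ (n / (1 + numRoles k) - 1) ≤ 2 ^ k * F'.card :=
  (hasSparseTriggers_chainTree (by omega) k 1).le_card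
    (levelVar_notMem_vars_chainTree (i := 0) (s := 0) (by omega))
    (fun _ hb => models_separatingSeq hb) (separatingSeq_mem_CLS k n)
    ⟨_, models_true_separatingSeq k n⟩ heq hW

/-- Only the empty clause has no literal occurrence. -/
lemma card_le_numLitOcc_add_one (F : Finset (Finset Lit)) : F.card ≤ numLitOcc F + 1 := by
  have h1 : (F.erase ∅).card ≤ numLitOcc F := by
    rw [Finset.card_eq_sum_ones]
    refine (Finset.sum_le_sum fun C hC => ?_).trans
      (Finset.sum_le_sum_of_subset (f := Finset.card) (Finset.erase_subset _ _))
    rw [Nat.one_le_iff_ne_zero, Ne, Finset.card_eq_zero]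
    exact (Finset.mem_erase.1 hC).1
  have h2 := Finset.pred_card_le_card_erase (s := F) (a := ∅)
  omega

open Asymptotics Filter in
lemma not_isBigO_of_two_pow_le {f : ℕ → ℕ} {c k : ℕ} (hc : 1 ≤ c)
    (hf : ∀ n, 2 ≤ n / c → 2 ^ (n / c - 1) ≤ 2 ^ k * (f n + 1)) (a : ℕ) :
    ¬ (fun n : ℕ => (f n : ℝ)) =O[atTop] (fun n : ℕ => (n : ℝ) ^ a) := by
  intro h
  obtain ⟨C, hC⟩ := h.bound
  obtain ⟨n₀, hn₀⟩ := eventually_atTop.1 hC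
  -- `K` absorbs the bound on `f` at `n = c * (m + 1) ≤ 2 * c * m`; the absolute value is needed as
  -- `C` may be negative.
  let K : ℝ := 2 ^ k * (|C| * (2 * c) ^ a + 1)
  have hK : 0 < K := by positivity
  -- The factor `(2 * K)⁻¹` makes `K * m ^ a` at most half of `2 ^ m`, contradicting `2 ^ m ≤ K * m
  -- ^ a`.
  have hlo := (isLittleO_pow_const_const_pow_of_one_lt (R := ℝ) a (r := (2 : ℝ)) one_lt_two).bound
    (c := (2 * K)⁻¹) (by positivity)
  obtain ⟨m, hm⟩ := ((hlo.and (eventually_ge_atTop (n₀ + 1)))).exists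
  have hdiv : c * (m + 1) / c = m + 1 := Nat.mul_div_cancel_left _ hc
  have h1 := hf (c * (m + 1)) (by rw [hdiv]; omega)
  rw [hdiv, Nat.add_sub_cancel] at h1
  have h1' : (2 : ℝ) ^ m ≤ 2 ^ k * (f (c * (m + 1)) + 1) := by exact_mod_cast h1
  have h2 := hn₀ (c * (m + 1)) (by nlinarith [hm.2])
  rw [Real.norm_of_nonneg (by positivity), Real.norm_of_nonneg (by positivity)] at h2
  have hm1 : (1 : ℝ) ≤ m := by exact_mod_cast (by omega : 1 ≤ m)
  have h3 : ((c * (m + 1) : ℕ) : ℝ) ^ a ≤ (2 * c) ^ a * (m : ℝ) ^ a := by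
    rw [← mul_pow]
    refine pow_le_pow_left₀ (by positivity) ?_ a
    push_cast
    have : (0 : ℝ) ≤ c := by positivity
    nlinarith
  have h4 : (f (c * (m + 1)) : ℝ) ≤ |C| * ((2 * c) ^ a * (m : ℝ) ^ a) :=
    h2.trans (mul_le_mul (le_abs_self C) h3 (by positivity) (abs_nonneg C))
  have h5 : (1 : ℝ) ≤ (m : ℝ) ^ a := one_le_pow₀ hm1
  have h6 : (2 : ℝ) ^ m ≤ K * (m : ℝ) ^ a := by
    refine h1'.trans ?_
    rw [mul_assoc]
    refine mul_le_mul_of_nonneg_left ?_ (by positivity)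
    rw [add_mul, mul_assoc]
    linarith
  have h7 := hm.1
  rw [Real.norm_of_nonneg (by positivity), Real.norm_of_nonneg (by positivity),
    inv_mul_eq_div, le_div_iff₀ (by positivity)] at h7
  have : (0 : ℝ) < 2 ^ m := by positivity
  linarith

lemma notSimulates_of_polyTimeSequence {k : ℕ} (h : PolyTimeSequence (separatingSeq k)) :
    NotSimulates (WC k) (UC (k + 1)) := by
  refine ⟨separatingSeq k, fun n hn => ⟨separatingSeq_mem_UC hn, numVars_separatingSeq hn⟩, h, ?_⟩
  rintro ⟨F', hF', a, ha⟩
  refine not_isBigO_of_two_pow_le (f := fun n => numLitOcc (F' n)) (c := 1 + numRoles k) (k := k)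
    (by omega) (fun n hn => ?_) a ha
  have hn1 : 1 ≤ n := by
    by_contra h0
    have : n = 0 := by omega
    subst this
    simp at hn
  exact (two_pow_le_card_of_equivalent hn (hF' n hn1).2 (hF' n hn1).1).trans
    (Nat.mul_le_mul_left _ (card_le_numLitOcc_add_one _))

/-! ### Transducers -/

section Transducer

open Computability Turing

/-- The stacks of a transducer: the input, a unary counter, an auxiliary stack for copying the
counter, and the output. -/
inductive Stack : Type
  | input
  | counter
  | scratch
  | output
  deriving DecidableEq

instance : Fintype Stack :=
  ⟨{.input, .counter, .scratch, .output}, fun s => by cases s <;> simp⟩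

/-- The modes of a transducer: running the current program, copying the counter, restoring the
counter, and clearing the counter. -/
inductive Mode : Type
  | run
  | copying
  | restoring
  | clearing
  deriving DecidableEq

instance : Fintype Mode :=
  ⟨{.run, .copying, .restoring, .clearing}, fun m => by cases m <;> simp⟩

/-- The instructions of a transducer: output a symbol, output as many digits zero as given by the
counter, and increment the counter. -/
inductive Instr : Type
  | emit (s : Γ')
  | copy
  | incr

/-- The stack alphabets. -/
def StackAlphabet : Stack → Type
  | .output => Γ'
  | .input => Bool
  | .counter => Bool
  | .scratch => Bool

/-- The stacks with given contents. -/
def stackContents (i a b : List Bool) (o : List Γ') : ∀ s, List (StackAlphabet s)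
  | .output => o
  | .input => i
  | .counter => a
  | .scratch => b

/-- The effect of an instruction on the counter and the output. -/
def Instr.exec : Instr → ℕ × List Γ' → ℕ × List Γ'
  | .emit s, c => (c.1, s :: c.2)
  | .copy, c => (c.1, List.replicate c.1 (Γ'.bit false) ++ c.2)
  | .incr, c => (c.1 + 1, c.2)

/-- The effect of a program on the counter and the output. -/
def execProg : List Instr → ℕ × List Γ' → ℕ × List Γ'
  | [], c => c
  | i :: l, c => execProg l (i.exec c)

lemma execProg_append (l l' : List Instr) (c : ℕ × List Γ') :
    execProg (l ++ l') c = execProg l' (execProg l c) := by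
  induction l generalizing c with
  | nil => rfl
  | cons i l ih => exact ih _

lemma fst_execProg_le (l : List Instr) (c : ℕ × List Γ') : (execProg l c).1 ≤ c.1 + l.length := by
  induction l generalizing c with
  | nil => exact le_rfl
  | cons i l ih =>
    refine (ih _).trans ?_
    rw [List.length_cons]
    cases i <;> simp only [Instr.exec] <;> omega

variable {P : Type} (next : P → P) (body : P → List Instr)

/-- The phase, the counter and the output after reading `n` input symbols. -/
def transducerState (p₀ : P) : ℕ → P × ℕ × List Γ'
  | 0 => (p₀, 0, [])
  | n + 1 => (next (transducerState p₀ n).1,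
      execProg (body (transducerState p₀ n).1) (transducerState p₀ n).2)

/-- The remaining programs. -/
abbrev Rest : Type := {l : List Instr // ∃ p, l <:+ body p}

lemma rest_tail {i : Instr} {l : List Instr} (h : ∃ p, i :: l <:+ body p) : ∃ p, l <:+ body p :=
  let ⟨p, hp⟩ := h
  ⟨p, (List.suffix_cons i l).trans hp⟩

open TM2.Stmt in
/-- The statement executing the first instruction of the remaining program; after its end the next
input symbol is read. -/
def transducerStep (p : P) : Rest body →
    TM2.Stmt StackAlphabet (P × Rest body × Mode) (Option Bool)
  | ⟨[], h⟩ => pop .input (fun _ x => x) (TM2.Stmt.branch Option.isSome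
      (load (fun _ => none) (goto fun _ => (next p, ⟨body p, p, List.suffix_rfl⟩, .run)))
      (goto fun _ => (p, ⟨[], h⟩, .clearing)))
  | ⟨.emit s :: l, h⟩ =>
      push .output (fun _ => s) (goto fun _ => (p, ⟨l, rest_tail body h⟩, .run))
  | ⟨.incr :: l, h⟩ =>
      push .counter (fun _ => true) (goto fun _ => (p, ⟨l, rest_tail body h⟩, .run))
  | ⟨.copy :: l, h⟩ => goto fun _ => (p, ⟨l, rest_tail body h⟩, .copying)

open TM2.Stmt in
/-- The program of the machine. -/
def transducerProgram : P × Rest body × Mode →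
    TM2.Stmt StackAlphabet (P × Rest body × Mode) (Option Bool)
  | (p, r, .run) => transducerStep next body p r
  | (p, r, .copying) => pop .counter (fun _ x => x) (TM2.Stmt.branch Option.isSome
      (push .output (fun _ => Γ'.bit false) (push .scratch (fun _ => true)
        (load (fun _ => none) (goto fun _ => (p, r, .copying)))))
      (goto fun _ => (p, r, .restoring)))
  | (p, r, .restoring) => pop .scratch (fun _ x => x) (TM2.Stmt.branch Option.isSome
      (push .counter (fun _ => true) (load (fun _ => none) (goto fun _ => (p, r, .restoring))))
      (goto fun _ => (p, r, .run)))
  | (p, r, .clearing) => pop .counter (fun _ x => x) (TM2.Stmt.branch Option.isSome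
      (load (fun _ => none) (goto fun _ => (p, r, .clearing))) halt)

/-- The configurations. -/
abbrev TransducerCfg : Type :=
  TM2.Cfg StackAlphabet (P × Rest body × Mode) (Option Bool)

/-- `c'` is reached from `c` in at most `t` steps. -/
def ReachesIn (c : TransducerCfg body) (t : ℕ) (c' : TransducerCfg body) : Prop :=
  ∃ s ≤ t, (flip Bind.bind (TM2.step (transducerProgram next body)))^[s] (some c) = some c'

variable {next body}

lemma ReachesIn.trans {c c' c'' : TransducerCfg body} {t t' : ℕ}
    (h : ReachesIn next body c t c') (h' : ReachesIn next body c' t' c'') :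
    ReachesIn next body c (t + t') c'' := by
  obtain ⟨s, hs, h⟩ := h
  obtain ⟨s', hs', h'⟩ := h'
  exact ⟨s' + s, by omega, by rw [Function.iterate_add_apply, h, h']⟩

lemma ReachesIn.mono {c c' : TransducerCfg body} {t t' : ℕ}
    (h : ReachesIn next body c t c') (ht : t ≤ t') : ReachesIn next body c t' c' :=
  let ⟨s, hs, h⟩ := h
  ⟨s, hs.trans ht, h⟩

lemma ReachesIn.refl (c : TransducerCfg body) : ReachesIn next body c 0 c := ⟨0, le_rfl, rfl⟩

lemma ReachesIn.step {q : P × Rest body × Mode} {l' : Option (P × Rest body × Mode)}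
    {v v' : Option Bool} {S S' S'' : ∀ s, List (StackAlphabet s)}
    (h : TM2.stepAux (transducerProgram next body q) v S = ⟨l', v', S''⟩)
    (hS : ∀ s, S'' s = S' s) : ReachesIn next body ⟨some q, v, S⟩ 1 ⟨l', v', S'⟩ := by
  obtain rfl := funext hS
  exact ⟨1, le_rfl, congrArg some h⟩

/-- Reading the counter empties it, so each mark is saved on the scratch stack;
`reachesIn_restoring` moves the marks back. -/
lemma reachesIn_copying (p : P) (r : Rest body) (i : List Bool) (a b : ℕ) (o : List Γ') :
    ReachesIn next body
      ⟨some (p, r, .copying), none, stackContents i (List.replicate a true) (List.replicate b true) o⟩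
      (a + 1)
      ⟨some (p, r, .restoring), none,
        stackContents i [] (List.replicate (a + b) true) (List.replicate a (Γ'.bit false) ++ o)⟩ := by
  induction a generalizing b o with
  | zero =>
    rw [zero_add b]
    exact ReachesIn.step rfl fun s => by cases s <;> rfl
  | succ a ih =>
    have h1 : ReachesIn next body
        ⟨some (p, r, .copying), none,
          stackContents i (List.replicate (a + 1) true) (List.replicate b true) o⟩ 1
        ⟨some (p, r, .copying), none, stackContents i (List.replicate a true)
          (List.replicate (b + 1) true) (Γ'.bit false :: o)⟩ := by
      exact ReachesIn.step rfl fun s => by cases s <;> rfl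
    have h2 := h1.trans (ih (b + 1) (Γ'.bit false :: o))
    rw [show a + (b + 1) = a + 1 + b by omega] at h2
    rw [List.replicate_succ' (a := Γ'.bit false), List.append_assoc]
    exact h2.mono (by omega)

lemma reachesIn_restoring (p : P) (r : Rest body) (i : List Bool) (a b : ℕ) (o : List Γ') :
    ReachesIn next body
      ⟨some (p, r, .restoring), none, stackContents i (List.replicate a true) (List.replicate b true) o⟩
      (b + 1)
      ⟨some (p, r, .run), none, stackContents i (List.replicate (a + b) true) [] o⟩ := by
  induction b generalizing a with
  | zero =>
    exact ReachesIn.step rfl fun s => by cases s <;> rfl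
  | succ b ih =>
    have h1 : ReachesIn next body
        ⟨some (p, r, .restoring), none,
          stackContents i (List.replicate a true) (List.replicate (b + 1) true) o⟩ 1
        ⟨some (p, r, .restoring), none, stackContents i (List.replicate (a + 1) true)
          (List.replicate b true) o⟩ := by
      exact ReachesIn.step rfl fun s => by cases s <;> rfl
    have h2 := h1.trans (ih (a + 1))
    rw [show a + 1 + b = a + (b + 1) by omega] at h2
    exact h2.mono (by omega)

/-- A halting configuration must have all stacks but the output empty. -/
lemma reachesIn_clearing (p : P) (r : Rest body) (a : ℕ) (o : List Γ') :
    ReachesIn next body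
      ⟨some (p, r, .clearing), none, stackContents [] (List.replicate a true) [] o⟩
      (a + 1) ⟨none, none, stackContents [] [] [] o⟩ := by
  induction a with
  | zero =>
    exact ReachesIn.step rfl fun s => by cases s <;> rfl
  | succ a ih =>
    have h1 : ReachesIn next body
        ⟨some (p, r, .clearing), none, stackContents [] (List.replicate (a + 1) true) [] o⟩ 1
        ⟨some (p, r, .clearing), none, stackContents [] (List.replicate a true) [] o⟩ := by
      exact ReachesIn.step rfl fun s => by cases s <;> rfl
    exact (h1.trans ih).mono (by omega)

/-- An instruction costs at most `2 * a + 3` steps for counter value `a`, the worst case being a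
copy and its restoration; the counter grows by at most one per instruction. -/
lemma reachesIn_execProg (p : P) (i : List Bool) (l : List Instr) (h : ∃ p, l <:+ body p)
    (h' : ∃ p, [] <:+ body p) (a : ℕ) (o : List Γ') :
    ReachesIn next body
      ⟨some (p, ⟨l, h⟩, .run), none, stackContents i (List.replicate a true) [] o⟩
      (l.length * (2 * (a + l.length) + 3))
      ⟨some (p, ⟨[], h'⟩, .run), none, stackContents i (List.replicate (execProg l (a, o)).1 true) []
        (execProg l (a, o)).2⟩ := by
  induction l generalizing a o with
  | nil => exact (ReachesIn.refl _).mono (by omega)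
  | cons x l ih =>
    cases x with
    | emit s =>
      have h1 : ReachesIn next body
          ⟨some (p, ⟨.emit s :: l, h⟩, .run), none, stackContents i (List.replicate a true) [] o⟩ 1
          ⟨some (p, ⟨l, rest_tail body h⟩, .run), none,
            stackContents i (List.replicate a true) [] (s :: o)⟩ := by
        exact ReachesIn.step rfl fun s => by cases s <;> rfl
      refine (h1.trans (ih (rest_tail body h) a (s :: o))).mono ?_
      rw [List.length_cons]
      nlinarith
    | incr =>
      have h1 : ReachesIn next body
          ⟨some (p, ⟨.incr :: l, h⟩, .run), none, stackContents i (List.replicate a true) [] o⟩ 1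
          ⟨some (p, ⟨l, rest_tail body h⟩, .run), none,
            stackContents i (List.replicate (a + 1) true) [] o⟩ := by
        exact ReachesIn.step rfl fun s => by cases s <;> rfl
      refine (h1.trans (ih (rest_tail body h) (a + 1) o)).mono ?_
      rw [List.length_cons]
      nlinarith
    | copy =>
      have h1 : ReachesIn next body
          ⟨some (p, ⟨.copy :: l, h⟩, .run), none, stackContents i (List.replicate a true) [] o⟩ 1
          ⟨some (p, ⟨l, rest_tail body h⟩, .copying), none,
            stackContents i (List.replicate a true) [] o⟩ := by
        exact ReachesIn.step rfl fun s => by cases s <;> rfl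
      have h2 := reachesIn_copying (next := next) p ⟨l, rest_tail body h⟩ i a 0 o
      have h3 := reachesIn_restoring (next := next) p ⟨l, rest_tail body h⟩ i 0 a
        (List.replicate a (Γ'.bit false) ++ o)
      rw [zero_add] at h3
      refine (((h1.trans h2).trans h3).trans (ih (rest_tail body h) a _)).mono ?_
      rw [List.length_cons]
      nlinarith

lemma fst_transducerState_le {L : ℕ} (hL : ∀ p, (body p).length ≤ L) (p₀ : P) (n : ℕ) :
    (transducerState next body p₀ n).2.1 ≤ L * n := by
  induction n with
  | zero => simp [transducerState]
  | succ n ih =>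
    refine (fst_execProg_le _ _).trans ?_
    have := hL (transducerState next body p₀ n).1
    rw [mul_add]
    omega

lemma reachesIn_transducerState {L : ℕ} (hL : ∀ p, (body p).length ≤ L) (p₀ : P) (n m : ℕ)
    (h : ∃ p, [] <:+ body p) :
    ReachesIn next body
      ⟨some (p₀, ⟨[], h⟩, .run), none, stackContents (List.replicate (m + n) true) [] [] []⟩
      (n * (L * (2 * (L * n + L) + 3) + 1))
      ⟨some ((transducerState next body p₀ n).1, ⟨[], h⟩, .run), none,
        stackContents (List.replicate m true)
          (List.replicate (transducerState next body p₀ n).2.1 true) []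
          (transducerState next body p₀ n).2.2⟩ := by
  induction n generalizing m with
  | zero => exact (ReachesIn.refl _).mono (by omega)
  | succ n ih =>
    have h1 := ih (m + 1)
    rw [show m + 1 + n = m + (n + 1) by omega] at h1
    obtain ⟨p, a, o, hs⟩ : ∃ p a o, transducerState next body p₀ n = (p, a, o) :=
      ⟨_, _, _, rfl⟩
    have ha := fst_transducerState_le (next := next) hL p₀ n
    rw [transducerState]
    rw [hs] at h1 ha ⊢
    -- The phase is advanced as soon as the symbol is read, while the program still to be run is
    -- that of the old phase.
    have h2 : ReachesIn next body
        ⟨some (p, ⟨[], h⟩, .run), none,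
          stackContents (List.replicate (m + 1) true) (List.replicate a true) [] o⟩ 1
        ⟨some (next p, ⟨body p, p, List.suffix_rfl⟩, .run), none,
          stackContents (List.replicate m true) (List.replicate a true) [] o⟩ := by
      exact ReachesIn.step rfl fun s => by cases s <;> rfl
    have h3 := reachesIn_execProg (next := next) (next p) (List.replicate m true) (body p)
      ⟨p, List.suffix_rfl⟩ h a o
    refine ((h1.trans h2).trans h3).mono ?_
    have hlen := hL p
    have e1 : (body p).length * (2 * (a + (body p).length) + 3) ≤
        L * (2 * (L * (n + 1) + L) + 3) := by
      refine Nat.mul_le_mul hlen ?_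
      have hmul : L * (n + 1) = L * n + L := Nat.mul_succ L n
      simp only at ha
      omega
    have e2 : n * (L * (2 * (L * n + L) + 3) + 1) ≤
        n * (L * (2 * (L * (n + 1) + L) + 3) + 1) := by
      refine Nat.mul_le_mul_left _ ?_
      refine Nat.add_le_add_right (Nat.mul_le_mul_left _ ?_) _
      have hmul : L * (n + 1) = L * n + L := Nat.mul_succ L n
      omega
    rw [add_mul]
    omega

/-! ### Transducers run in polynomial time -/

lemma unaryEncodeNat_eq_replicate (n : ℕ) : unaryEncodeNat n = List.replicate n true := by
  induction n with
  | zero => rfl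
  | succ n ih => rw [unaryEncodeNat, ih, List.replicate_succ]

variable (next body)

/-- The Turing machine given by a transducer. -/
noncomputable def transducer [Fintype P] (p₀ : P) : FinTM2 where
  K := Stack
  k₀ := .input
  k₁ := .output
  Γ := StackAlphabet
  Λ := P × Rest body × Mode
  main := (p₀, ⟨[], p₀, List.nil_suffix⟩, .run)
  ΛFin := by
    haveI : Finite (Rest body) := by
      refine Set.Finite.subset (s := ⋃ p, {l | l ∈ (body p).tails})
        (Set.finite_iUnion fun p => List.finite_toSet _) fun l hl => ?_
      obtain ⟨p, hp⟩ := hl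
      exact Set.mem_iUnion.2 ⟨p, (List.mem_tails _ _).2 hp⟩
    haveI : Fintype (Rest body) := Fintype.ofFinite _
    infer_instance
  σ := Option Bool
  initialState := none
  Γk₀Fin := inferInstanceAs (Fintype Bool)
  m := transducerProgram next body

/-- With `L` bounding the program lengths, the counter is at most `L * n` after `n` symbols, so the
total time is polynomial in `n`; the last two summands are for detecting the end of the input and
clearing the counter. -/
lemma transducer_computes [Fintype P] (p₀ : P) {g : ℕ → List (List Lit)}
    (hg : ∀ n, (transducerState next body p₀ n).2.2 = encodeClauseList (g n)) :
    Nonempty (TM2ComputableInPolyTime unaryEncodeNat encodeClauseList g) := by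
  obtain ⟨L, hL⟩ : ∃ L, ∀ p, (body p).length ≤ L :=
    ⟨Finset.univ.sup fun p => (body p).length,
      fun p => Finset.le_sup (f := fun p => (body p).length) (Finset.mem_univ p)⟩
  have key : ∀ n, ReachesIn next body
      ⟨some (p₀, ⟨[], p₀, List.nil_suffix⟩, .run), none,
        stackContents (List.replicate n true) [] [] []⟩
      (n * (L * (2 * (L * n + L) + 3) + 1) + 1 + (L * n + 1))
      ⟨none, none, stackContents [] [] [] (encodeClauseList (g n))⟩ := by
    intro n
    have h1 := reachesIn_transducerState (next := next) hL p₀ n 0 ⟨p₀, List.nil_suffix⟩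
    rw [zero_add] at h1
    have ha := fst_transducerState_le (next := next) hL p₀ n
    have h2 : ∀ p a o, ReachesIn next body
        ⟨some (p, ⟨[], p₀, List.nil_suffix⟩, .run), none,
          stackContents (List.replicate 0 true) (List.replicate a true) [] o⟩ 1
        ⟨some (p, ⟨[], p₀, List.nil_suffix⟩, .clearing), none,
          stackContents [] (List.replicate a true) [] o⟩ := by
      intro p a o
      exact ReachesIn.step rfl fun s => by cases s <;> rfl
    rw [← hg]
    exact ((h1.trans (h2 _ _ _)).trans (reachesIn_clearing _ _ _ _)).mono (by omega)
  let T : Polynomial ℕ := Polynomial.X * (Polynomial.C L * (2 * (Polynomial.C L * Polynomial.X +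
    Polynomial.C L) + 3) + 1) + 1 + (Polynomial.C L * Polynomial.X + 1)
  have hT : ∀ n, T.eval n = n * (L * (2 * (L * n + L) + 3) + 1) + 1 + (L * n + 1) := by
    intro n
    simp [T]
  refine ⟨{
    tm := transducer next body p₀
    inputAlphabet := Equiv.refl Bool
    outputAlphabet := Equiv.refl Γ'
    time := T
    outputsFun := fun n => ?_ }⟩
  have hinit : initList (transducer next body p₀)
      (List.map (Equiv.refl Bool).invFun (unaryEncodeNat n)) =
      (⟨some (p₀, ⟨[], p₀, List.nil_suffix⟩, .run), none,
        stackContents (List.replicate n true) [] [] []⟩ : TransducerCfg body) := by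
    rw [← unaryEncodeNat_eq_replicate]
    unfold initList
    congr 1
    funext s
    cases s
    · exact List.map_id _
    all_goals rfl
  have hhalt : haltList (transducer next body p₀)
      (List.map (Equiv.refl Γ').invFun (encodeClauseList (g n))) =
      (⟨none, none, stackContents [] [] [] (encodeClauseList (g n))⟩ : TransducerCfg body) := by
    unfold haltList
    congr 1
    funext s
    cases s
    on_goal 4 => exact List.map_id _
    all_goals rfl
  have hlen : (unaryEncodeNat n).length = n := by
    rw [unaryEncodeNat_eq_replicate, List.length_replicate]
  choose s hs h using key n
  exact {
    steps := s
    evals_in_steps := by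
      refine Eq.trans ?_ (h.trans (congrArg some hhalt.symm))
      exact congrArg (fun c => (flip Bind.bind (TM2.step (transducerProgram next body)))^[s] (some c))
        hinit
    steps_le_m := by
      rw [hlen, hT]
      exact hs }

end Transducer

/-! ### Computation of the separating sequence -/

section Templates

open Computability

lemma encodeNat_two_mul {n : ℕ} (hn : 0 < n) : encodeNat (2 * n) = false :: encodeNat n := by
  have h : ((2 * n : ℕ) : Num) = Num.bit0 (n : Num) := by
    rw [two_mul, Nat.cast_add, Num.bit0_of_bit0]
  have h' : (n : Num) ≠ 0 := by
    intro h
    have := congrArg (fun x : Num => (x : ℕ)) h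
    simp only [Num.to_of_nat] at this
    exact hn.ne' this
  unfold encodeNat
  rw [h]
  cases hx : (n : Num) with
  | zero => exact absurd hx h'
  | pos p => rfl

/-- Digits are listed with the least significant first, so the level is a block of leading zeros
that can be copied from a unary counter. -/
lemma encodeNat_levelVar (i s : ℕ) :
    encodeNat (levelVar i s) = List.replicate i false ++ encodeNat (2 * s + 1) := by
  induction i with
  | zero => simp [levelVar]
  | succ i ih =>
    have : levelVar (i + 1) s = 2 * levelVar i s := by
      rw [levelVar, levelVar, pow_succ]
      ring
    rw [this, encodeNat_two_mul (by unfold levelVar; positivity), ih, List.replicate_succ,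
      List.cons_append]

/-- The levels of variables relative to a counter: level zero, the value of the counter, and its
successor. -/
inductive Level : Type
  | zero
  | cur
  | succ

/-- The value of a level. -/
def Level.eval (a : ℕ) : Level → ℕ
  | .zero => 0
  | .cur => a
  | .succ => a + 1

/-- A literal with a relative level: the level, the role and the sign. -/
abbrev LitTemplate : Type := Level × ℕ × Bool

/-- The value of a literal template. -/
def LitTemplate.eval (a : ℕ) (t : LitTemplate) : Lit := (levelVar (t.1.eval a) t.2.1, t.2.2)

/-- The program for the leading digits of a variable of the given level. -/
def Level.prog : Level → List Instr
  | .zero => []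
  | .cur => [.copy]
  | .succ => [.copy, .emit (Γ'.bit false)]

/-- The program writing a literal. -/
def LitTemplate.prog (t : LitTemplate) : List Instr :=
  .emit Γ'.comma :: ((encodeNat (2 * t.2.1 + 1)).reverse.map (fun b => .emit (Γ'.bit b)) ++
    (t.1.prog ++ [.emit (Γ'.bit t.2.2)]))

/-- The program writing a clause. -/
def clauseProg (C : List LitTemplate) : List Instr :=
  .emit Γ'.ket :: (C.reverse.flatMap LitTemplate.prog ++ [.emit Γ'.bra])

/-- The program writing a list of clauses. -/
def clauseListProg (L : List (List LitTemplate)) : List Instr :=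
  L.reverse.flatMap clauseProg

lemma execProg_emit (l : List Γ') (a : ℕ) (o : List Γ') :
    execProg (l.reverse.map .emit) (a, o) = (a, l ++ o) := by
  induction l generalizing o with
  | nil => rfl
  | cons s l ih =>
    rw [List.reverse_cons, List.map_append, execProg_append, ih]
    rfl

lemma execProg_level (L : Level) (a : ℕ) (o : List Γ') :
    execProg L.prog (a, o) = (a, List.replicate (L.eval a) (Γ'.bit false) ++ o) := by
  cases L with
  | zero => rfl
  | cur => rfl
  | succ =>
    rw [Level.eval, List.replicate_succ]
    rfl

lemma execProg_reverse_flatMap {α : Type} {f : α → List Instr} {g : α → List Γ'} {a : ℕ}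
    (h : ∀ x o, execProg (f x) (a, o) = (a, g x ++ o)) (l : List α) (o : List Γ') :
    execProg (l.reverse.flatMap f) (a, o) = (a, l.flatMap g ++ o) := by
  induction l generalizing o with
  | nil => rfl
  | cons x l ih =>
    rw [List.reverse_cons, List.flatMap_append, execProg_append, ih, List.flatMap_cons,
      List.flatMap_nil, List.append_nil, h, List.flatMap_cons, List.append_assoc]

/-- The output is a stack, so each program emits its string from the end: comma, role digits, level
digits, sign. -/
lemma execProg_lit (t : LitTemplate) (a : ℕ) (o : List Γ') :
    execProg t.prog (a, o) = (a, encodeLit (t.eval a) ++ o) := by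
  have h : (encodeNat (2 * t.2.1 + 1)).reverse.map (fun b => Instr.emit (Γ'.bit b)) =
      (((encodeNat (2 * t.2.1 + 1)).map Γ'.bit).reverse).map Instr.emit := by
    rw [← List.map_reverse, List.map_map]
    rfl
  rw [LitTemplate.prog, execProg, Instr.exec, execProg_append, h, execProg_emit, execProg_append,
    execProg_level]
  simp [execProg, Instr.exec, encodeLit, LitTemplate.eval, encodeNat_levelVar]

lemma execProg_clause (C : List LitTemplate) (a : ℕ) (o : List Γ') :
    execProg (clauseProg C) (a, o) =
      (a, encodeClause (C.map (LitTemplate.eval a)) ++ o) := by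
  rw [clauseProg, execProg, Instr.exec, execProg_append,
    execProg_reverse_flatMap (fun t o => execProg_lit t a o)]
  simp [execProg, Instr.exec, encodeClause, List.flatMap_map]

lemma execProg_clauseList (L : List (List LitTemplate)) (a : ℕ) (o : List Γ') :
    execProg (clauseListProg L) (a, o) =
      (a, encodeClauseList (L.map (List.map (LitTemplate.eval a))) ++ o) := by
  rw [clauseListProg, execProg_reverse_flatMap (fun C o => execProg_clause C a o)]
  simp [encodeClauseList, List.flatMap_map]

/-- The templates of the clauses of a complete tree of chains. -/
def treeTemplate : ℕ → ℕ → List (List LitTemplate)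
  | 0, o => [[(.cur, o, false), (.succ, o, true), (.succ, o + 1, true)],
      [(.cur, o, false), (.succ, o, true), (.succ, o + 2, true)]]
  | d + 1, o => (treeTemplate d (o + 1)).map (List.cons (.zero, o, true)) ++
      (treeTemplate d (o + 1 + numRoles d)).map (List.cons (.zero, o, false))

/-- All links of the chains look alike up to a shift of levels, so a fixed finite list of templates
describes the whole tree at each counter value. -/
lemma mem_chainTree {d o m : ℕ} {C : Finset Lit} : C ∈ chainTree d o m ↔
    ∃ a < m, ∃ t ∈ treeTemplate d o, (t.map (LitTemplate.eval a)).toFinset = C := by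
  induction d generalizing o C with
  | zero =>
    rw [chainTree, mem_chain]
    refine exists_congr fun a => and_congr_right fun _ => ?_
    simp only [treeTemplate, List.mem_cons, List.not_mem_nil, or_false]
    constructor
    · rintro ⟨r, rfl | rfl, rfl⟩
      · exact ⟨_, Or.inl rfl, by simp [chainClause, LitTemplate.eval, Level.eval]⟩
      · exact ⟨_, Or.inr rfl, by simp [chainClause, LitTemplate.eval, Level.eval]⟩
    · rintro ⟨t, rfl | rfl, rfl⟩
      · exact ⟨1, Or.inl rfl, by simp [chainClause, LitTemplate.eval, Level.eval]⟩
      · exact ⟨2, Or.inr rfl, by simp [chainClause, LitTemplate.eval, Level.eval]⟩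
  | succ d ih =>
    rw [chainTree, mem_branch]
    simp only [treeTemplate, List.mem_append, List.mem_map]
    constructor
    · rintro (⟨D, hD, rfl⟩ | ⟨D, hD, rfl⟩)
      · obtain ⟨a, ha, t, ht, rfl⟩ := ih.1 hD
        exact ⟨a, ha, _, Or.inl ⟨t, ht, rfl⟩, by simp [LitTemplate.eval, Level.eval]⟩
      · obtain ⟨a, ha, t, ht, rfl⟩ := ih.1 hD
        exact ⟨a, ha, _, Or.inr ⟨t, ht, rfl⟩, by simp [LitTemplate.eval, Level.eval]⟩
    · rintro ⟨a, ha, t, ⟨t, ht, rfl⟩ | ⟨t, ht, rfl⟩, rfl⟩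
      · exact Or.inl ⟨_, ih.2 ⟨a, ha, t, ht, rfl⟩, by simp [LitTemplate.eval, Level.eval]⟩
      · exact Or.inr ⟨_, ih.2 ⟨a, ha, t, ht, rfl⟩, by simp [LitTemplate.eval, Level.eval]⟩

/-! ### Scheduling the output of the separating sequence by phases -/

variable (k : ℕ)

/-- The phases: whether all roles of level zero are done, and the current role. -/
abbrev Phase : Type := Bool × Fin (1 + numRoles k)

/-- The phase after `n` steps. -/
def phaseOf (n : ℕ) : Phase k :=
  (decide (1 + numRoles k ≤ n), ⟨n % (1 + numRoles k), Nat.mod_lt _ (by omega)⟩)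

/-- The successor of a phase. -/
def nextPhase (p : Phase k) : Phase k :=
  if h : p.2.1 + 1 < 1 + numRoles k then (p.1, ⟨p.2.1 + 1, h⟩) else (true, ⟨0, by omega⟩)

/-- The last role of a positive level. -/
def IsLastRole (p : Phase k) : Prop := p.1 = true ∧ p.2.1 = numRoles k

instance (p : Phase k) : Decidable (IsLastRole k p) :=
  inferInstanceAs (Decidable (p.1 = true ∧ p.2.1 = numRoles k))

/-- The templates of the clauses written in the given phase. -/
def phaseTemplate (p : Phase k) : List (List LitTemplate) :=
  [(.zero, 0, true), (if p.1 then .succ else .zero, p.2.1, true)] ::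
    if IsLastRole k p then treeTemplate k 1 else []

/-- The program of the given phase. -/
def phaseProg (p : Phase k) : List Instr :=
  clauseListProg (phaseTemplate k p) ++ if IsLastRole k p then [.incr] else []

/-- The list of clauses written in `n` steps. -/
def separatingList : ℕ → List (List Lit)
  | 0 => []
  | n + 1 => (phaseTemplate k (phaseOf k n)).map
      (List.map (LitTemplate.eval (n / (1 + numRoles k) - 1))) ++ separatingList n

lemma div_mod_succ (c n : ℕ) (hc : 0 < c) :
    (n % c + 1 < c ∧ (n + 1) % c = n % c + 1 ∧ (n + 1) / c = n / c) ∨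
    (n % c + 1 = c ∧ (n + 1) % c = 0 ∧ (n + 1) / c = n / c + 1) := by
  have h1 := Nat.div_add_mod n c
  have h2 := Nat.mod_lt n hc
  by_cases h : n % c + 1 < c
  · left
    have e : n + 1 = n % c + 1 + c * (n / c) := by omega
    refine ⟨h, ?_, ?_⟩
    · rw [e, Nat.add_mul_mod_self_left, Nat.mod_eq_of_lt h]
    · rw [e, Nat.add_mul_div_left _ _ hc, Nat.div_eq_of_lt h, zero_add]
  · right
    have e : n + 1 = c * (n / c + 1) := by rw [mul_add]; omega
    refine ⟨by omega, ?_, ?_⟩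
    · rw [e, Nat.mul_mod_right]
    · rw [e, Nat.mul_div_cancel_left _ hc]

lemma one_le_div_iff {c n : ℕ} (hc : 0 < c) : 1 ≤ n / c ↔ c ≤ n := by
  rw [Nat.le_div_iff_mul_le hc, one_mul]

lemma nextPhase_phaseOf (n : ℕ) : nextPhase k (phaseOf k n) = phaseOf k (n + 1) := by
  have hc : 0 < 1 + numRoles k := by omega
  have h1 := one_le_div_iff (n := n) hc
  have h2 := one_le_div_iff (n := n + 1) hc
  rcases div_mod_succ (1 + numRoles k) n hc with ⟨a, b, c⟩ | ⟨a, b, c⟩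
  · rw [nextPhase, dif_pos (show (phaseOf k n).2.1 + 1 < _ from a)]
    rw [c, h1] at h2
    simp [phaseOf, b, h2]
  · rw [nextPhase, dif_neg (show ¬ (phaseOf k n).2.1 + 1 < 1 + numRoles k from a.not_lt)]
    have : 1 + numRoles k ≤ n + 1 := h2.1 (by rw [c]; exact Nat.le_add_left _ _)
    simp only [phaseOf, b, this, decide_true]

lemma isLastRole_phaseOf (n : ℕ) : IsLastRole k (phaseOf k n) ↔
    1 + numRoles k ≤ n ∧ n % (1 + numRoles k) = numRoles k := by
  simp [IsLastRole, phaseOf]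

lemma encodeClauseList_append (L L' : List (List Lit)) :
    encodeClauseList (L ++ L') = encodeClauseList L ++ encodeClauseList L' :=
  List.flatMap_append

/-- The counter lags one level behind the current variable. It stays `0` during level zero by
truncated subtraction, which is why only last roles of positive levels increment it. -/
lemma transducerState_separating (n : ℕ) :
    transducerState (nextPhase k) (phaseProg k) (phaseOf k 0) n =
      (phaseOf k n, n / (1 + numRoles k) - 1, encodeClauseList (separatingList k n)) := by
  induction n with
  | zero => simp [transducerState, separatingList, encodeClauseList]
  | succ n ih =>
    rw [transducerState, ih, nextPhase_phaseOf, phaseProg, execProg_append, execProg_clauseList,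
      separatingList, encodeClauseList_append]
    have hc : 0 < 1 + numRoles k := by omega
    have h1 := one_le_div_iff (n := n) hc
    have h2 := isLastRole_phaseOf k n
    split_ifs with h
    · rw [h2] at h
      rcases div_mod_succ (1 + numRoles k) n hc with ⟨a, b, c⟩ | ⟨a, b, c⟩
      · omega
      · have : n / (1 + numRoles k) - 1 + 1 = (n + 1) / (1 + numRoles k) - 1 := by omega
        simp only [execProg, Instr.exec, this]
    · rw [h2] at h
      have : n / (1 + numRoles k) - 1 = (n + 1) / (1 + numRoles k) - 1 := by
        rcases div_mod_succ (1 + numRoles k) n hc with ⟨a, b, c⟩ | ⟨a, b, c⟩ <;> omega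
      simp only [execProg]
      rw [← this]

lemma mem_ofClauseList_separatingList {n : ℕ} {C : Finset Lit} :
    C ∈ ofClauseList (separatingList k n) ↔ ∃ j < n, ∃ t ∈ phaseTemplate k (phaseOf k j),
      (t.map (LitTemplate.eval (j / (1 + numRoles k) - 1))).toFinset = C := by
  induction n with
  | zero => simp [separatingList, ofClauseList]
  | succ n ih =>
    have hsucc : C ∈ ofClauseList (separatingList k (n + 1)) ↔
        (∃ t ∈ phaseTemplate k (phaseOf k n),
          (t.map (LitTemplate.eval (n / (1 + numRoles k) - 1))).toFinset = C) ∨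
        C ∈ ofClauseList (separatingList k n) := by
      simp [ofClauseList, separatingList]
    rw [hsucc, ih]
    constructor
    · rintro (h | ⟨j, hj, h⟩)
      · exact ⟨n, Nat.lt_succ_self n, h⟩
      · exact ⟨j, hj.trans (Nat.lt_succ_self n), h⟩
    · rintro ⟨j, hj, h⟩
      rcases Nat.lt_succ_iff_lt_or_eq.1 hj with hj | rfl
      · exact Or.inr ⟨j, hj, h⟩
      · exact Or.inl h

lemma separatingSeq_eq_ofClauseList (n : ℕ) :
    separatingSeq k n = ofClauseList (separatingList k n) := by
  ext C
  have hc : 0 < 1 + numRoles k := by omega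
  have hseq : ∀ j, ([(.zero, 0, true), (if (phaseOf k j).1 then .succ else .zero,
      (phaseOf k j).2.1, true)].map (LitTemplate.eval (j / (1 + numRoles k) - 1))).toFinset =
      ({(levelVar 0 0, true), (seqVar (1 + numRoles k) j, true)} : Finset Lit) := by
    intro j
    have h1 := one_le_div_iff (n := j) hc
    by_cases h : 1 + numRoles k ≤ j
    · have h2 := Nat.sub_add_cancel (h1.2 h)
      simp [phaseOf, h, LitTemplate.eval, Level.eval, seqVar, h2]
    · have h2 : j / (1 + numRoles k) = 0 := Nat.div_eq_of_lt (by omega)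
      simp [phaseOf, h, LitTemplate.eval, Level.eval, seqVar, h2]
  rw [mem_ofClauseList_separatingList, mem_separatingSeq, mem_chainTree]
  constructor
  · rintro (⟨j, hj, rfl⟩ | ⟨a, ha, t, ht, rfl⟩)
    · exact ⟨j, hj, _, List.mem_cons_self, hseq j⟩
    · have hlt := Nat.mul_le_mul_left (1 + numRoles k) (show a + 2 ≤ n / (1 + numRoles k) by omega)
      have hle := Nat.mul_div_le n (1 + numRoles k)
      have e : (1 + numRoles k) * (a + 2) = (1 + numRoles k) * (a + 1) + (1 + numRoles k) := by
        ring
      -- The clauses linking levels `a` and `a + 1` are written at the last role of level `a + 1`,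
      -- when the counter is `a`.
      refine ⟨(1 + numRoles k) * (a + 1) + numRoles k, by omega, t, ?_, ?_⟩
      · have hlast : IsLastRole k (phaseOf k ((1 + numRoles k) * (a + 1) + numRoles k)) := by
          rw [isLastRole_phaseOf]
          refine ⟨?_, by rw [Nat.mul_add_mod, Nat.mod_eq_of_lt (by omega)]⟩
          rw [mul_add]
          omega
        rw [phaseTemplate, if_pos hlast]
        exact List.mem_cons_of_mem _ ht
      · rw [Nat.mul_add_div hc, Nat.div_eq_of_lt (by omega : numRoles k < 1 + numRoles k)]
        rfl
  · rintro ⟨j, hj, t, ht, rfl⟩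
    rw [phaseTemplate, List.mem_cons] at ht
    rcases ht with rfl | ht
    · exact Or.inl ⟨j, hj, hseq j⟩
    · split_ifs at ht with h
      · rw [isLastRole_phaseOf] at h
        refine Or.inr ⟨j / (1 + numRoles k) - 1, ?_, t, ht, rfl⟩
        have h1 := one_le_div_iff (n := j) hc
        rcases div_mod_succ (1 + numRoles k) j hc with ⟨a, b, c⟩ | ⟨a, b, c⟩
        · omega
        · have := Nat.div_le_div_right (c := 1 + numRoles k) (show j + 1 ≤ n from hj)
          omega
      · simp at ht

lemma polyTimeSequence_separatingSeq : PolyTimeSequence (separatingSeq k) :=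
  ⟨separatingList k, transducer_computes (nextPhase k) (phaseProg k) (phaseOf k 0)
    (fun n => by rw [transducerState_separating]),
    fun n _ => separatingSeq_eq_ofClauseList k n⟩

end Templates

end ClauseSets

/-! ### Assembly of the theorem -/

open ClauseSets Asymptotics Filter
theorem theorem6p6 (k : ℕ) :
    NotSimulates (WC k) (UC (k + 1)) ∧
    (∀ h : ℕ, k + 1 ≤ h →
      ∃ T ∈ extremalTrees (k + 1) h, ∀ T' ∈ extremalTrees (k + 1) h, SwapEquiv T T') ∧
    ∀ (T : ℕ → LTree) (u : ℕ → Finset Lit → ℕ) (F : ℕ → Finset (Finset Lit)),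
      (∀ h : ℕ, k + 1 ≤ h →
        (T h).shape ∈ extremalTrees (k + 1) h ∧ (T h).labels.Nodup ∧
        IsDopingMap (T h).smu (u h) ∧ F h = doping (u h) (T h).smu) →
      (fun h : ℕ => (numVars (F h) : ℝ)) =Θ[atTop] (fun h : ℕ => (h : ℝ) ^ (k + 1)) ∧
      (fun h : ℕ => (numClauses (F h) : ℝ)) =Θ[atTop] (fun h : ℕ => (h : ℝ) ^ (k + 1)) ∧
      (∀ h : ℕ, k + 1 ≤ h → F h ∈ UC (k + 1)) ∧
      ∀ F' : ℕ → Finset (Finset Lit),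
        (∀ h : ℕ, k + 1 ≤ h → Equivalent (F' h) (F h) ∧ F' h ∈ WC k) →
        (fun h : ℕ => (2 : ℝ) ^ h / Real.sqrt (h : ℝ)) =O[atTop]
          (fun h : ℕ => (numClauses (F' h) : ℝ)) := by
  refine ⟨notSimulates_of_polyTimeSequence (polyTimeSequence_separatingSeq k),
    fun h hh => ⟨_, extremalTree_mem hh, fun T' hT' => swapEquiv_of_mem_extremalTrees hT'⟩,
    fun T u F hF => ?_⟩
  have hdoped : ∀ h, k + 1 ≤ h → IsDopedTree (T h).shape (F h) := by
    intro h hh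
    obtain ⟨-, h2, h3, h4⟩ := hF h hh
    rw [h4]
    exact isDopedTree_doping_smu _ _ h2 h3
  have hnodes : ∀ h, k + 1 ≤ h → (T h).shape.numNodes = (extremalTree (k + 1) h).numNodes :=
    fun h hh => numNodes_eq_of_mem_extremalTrees (hF h hh).1
  have hleaves : ∀ h, k + 1 ≤ h →
      (T h).shape.numLeaves = (extremalTree (k + 1) h).numLeaves := by
    intro h hh
    have h1 := FullTree.numNodes_add_one (T h).shape
    have h2 := FullTree.numNodes_add_one (extremalTree (k + 1) h)
    have := hnodes h hh
    omega
  obtain ⟨c, hc, d, hcd⟩ := numLeaves_extremalTree_bounds (k + 1)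
  refine ⟨?_, ?_, fun h hh => ?_, fun F' hF' => ?_⟩
  · have key : ∀ h, k + 1 ≤ h →
        (numVars (F h) : ℝ) + 1 = 2 * ((extremalTree (k + 1) h).numLeaves : ℝ) := by
      intro h hh
      rw [(hdoped h hh).numVars_eq, hnodes h hh]
      exact_mod_cast FullTree.numNodes_add_one _
    have hpos : ∀ h, (1 : ℝ) ≤ ((extremalTree (k + 1) h).numLeaves : ℝ) := by
      intro h
      have := FullTree.numNodes_add_one (extremalTree (k + 1) h)
      exact_mod_cast (by omega : 1 ≤ (extremalTree (k + 1) h).numLeaves)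
    -- The number of variables is twice the number of leaves minus one, hence lies between the
    -- number of leaves and its double.
    refine isTheta_pow_of_le_of_le (c := c) (d := 2 * d) hc ?_ ?_
    · filter_upwards [hcd, eventually_ge_atTop (k + 1)] with h h1 h2
      linarith [key h h2, hpos h]
    · filter_upwards [hcd, eventually_ge_atTop (k + 1)] with h h1 h2
      linarith [key h h2, hpos h]
  · have key : ∀ h, k + 1 ≤ h →
        (numClauses (F h) : ℝ) = ((extremalTree (k + 1) h).numLeaves : ℝ) := by
      intro h hh
      rw [(hdoped h hh).numClauses_eq, hleaves h hh]
    refine isTheta_pow_of_le_of_le (c := c) (d := d) hc ?_ ?_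
    · filter_upwards [hcd, eventually_ge_atTop (k + 1)] with h h1 h2
      rw [key h h2]
      exact h1.1
    · filter_upwards [hcd, eventually_ge_atTop (k + 1)] with h h1 h2
      rw [key h h2]
      exact h1.2
  · refine RefutableBy.mem_UC ?_ (hdoped h hh).mem_CLS (hdoped h hh).satisfiable
    exact (hdoped h hh).refutableBy.mono (hF h hh).1.1.le
  -- One factor `2 ^ k` makes up for the height `h - k` of the deep subtrees, the other for the
  -- implicates sharing a trigger. The square root is only used to be at least `1`.
  · refine IsBigO.of_bound ((2 : ℝ) ^ k * 2 ^ k) ?_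
    filter_upwards [eventually_ge_atTop (k + 1)] with h hh
    have hdeep : (T h).shape.DeepBelow k (h - k) :=
      (swapEquiv_of_mem_extremalTrees (hF h hh).1).deepBelow
        (deepBelow_extremalTree le_rfl (by omega))
    -- No forced variable is present here, so any fresh variable serves in `le_card`, with `E` and
    -- `F` the same.
    obtain ⟨v, hv⟩ := Infinite.exists_notMem_finset (vars (F h))
    have hle := ((hdoped h hh).hasSparseTriggers hdeep).le_card hv (fun _ _ => Iff.rfl)
      (hdoped h hh).mem_CLS (hdoped h hh).satisfiable (hF' h hh).1 (hF' h hh).2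
    have hle' : (2 : ℝ) ^ (h - k) ≤ 2 ^ k * ((F' h).card : ℝ) := by exact_mod_cast hle
    have hsqrt : (1 : ℝ) ≤ Real.sqrt h := by
      rw [Real.one_le_sqrt]
      exact_mod_cast (by omega : 1 ≤ h)
    rw [Real.norm_of_nonneg (by positivity), Real.norm_of_nonneg (by positivity), numClauses]
    refine (div_le_self (by positivity) hsqrt).trans ?_
    calc (2 : ℝ) ^ h = 2 ^ k * 2 ^ (h - k) := by
          rw [← pow_add]
          congr 1
          omega
      _ ≤ 2 ^ k * (2 ^ k * ((F' h).card : ℝ)) := by gcongr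
      _ = 2 ^ k * 2 ^ k * ((F' h).card : ℝ) := by ring
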